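/- In Generalized Bin Covering with unit supply, an instance consists of $m$ bins, where bin $i$ has profit $p_i\ge 0$ and demand $d_i>0$, and $n$ items, where item $j$ has size $s_j\ge 0$. A solution is a family $S=(S_1,\dots,S_m)$ of pairwise disjoint sets of items (items may stay unassigned), and its profit is $p(S)=\sum_{i\,:\,\sum_{j\in S_i}s_j\ge d_i}p_i$. Let $\mathrm{OPT}$ be the maximum profit of a solution. **Theorem.** There is a $5$-approximation algorithm for Generalized Bin Covering with unit supply that has running time $O(nm\sqrt{m+n})$. That is, there is an algorithm that computes, for every instance, a solution of profit $\mathrm{ALG}$ with $\mathrm{OPT}\le 5\cdot\mathrm{ALG}$, and there is a constant $C$ such that on every instance with $m,n\ge 1$ it halts within $C\,nm\sqrt{m+n}$ elementary operations of a unit-cost random access machine (and within $C$ operations if $m=0$ or $n=0$). The machine has memory cells for indices (natural numbers) and for real numbers. Its elementary operations are constants, memory access, addition, subtraction, assignment, comparison and branching. Real numbers are multiplied only in order to compare two products (equivalently, two ratios). -/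

import Mathlib

open scoped ENNReal

namespace GBC

/-! ## The problem -/

/-- An instance of Generalized Bin Covering with unit supply: `m` bins, where bin `i` has profit
`p i` and demand `d i`, and `n` items, where item `j` has size `s j`. -/
structure Instance where
  m : ℕ
  n : ℕ
  p : Fin m → ℝ
  d : Fin m → ℝ
  s : Fin n → ℝ
  p_nonneg : ∀ i, 0 ≤ p i
  d_pos : ∀ i, 0 < d i
  s_nonneg : ∀ j, 0 ≤ s j

/-- A solution: pairwise disjoint sets of items, one for each bin. Items may stay unassigned. -/
structure Solution (I : Instance) where
  S : Fin I.m → Finset (Fin I.n)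
  disjoint : ∀ i k, i ≠ k → Disjoint (S i) (S k)

/-- The total size of a set of items. -/
def Instance.size (I : Instance) (K : Finset (Fin I.n)) : ℝ := ∑ j ∈ K, I.s j

open Classical in
/-- The profit of a solution: the sum of the profits of the covered bins. -/
noncomputable def Solution.profit {I : Instance} (S : Solution I) : ℝ :=
  ∑ i : Fin I.m, if I.d i ≤ I.size (S.S i) then I.p i else 0

/-- The optimal profit of an instance. -/
noncomputable def opt (I : Instance) : ℝ≥0∞ := ⨆ S : Solution I, ENNReal.ofReal S.profit

/-- The approximation ratio of an algorithm, the supremum over all instances of the optimal profit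
divided by the profit of the algorithm. In `ℝ≥0∞` one has `a / 0 = ∞` for `a ≠ 0`, and `0 / 0 = 0`,
so an instance of optimal profit `0` imposes no condition. -/
noncomputable def approxRatio (alg : (I : Instance) → Solution I) : ℝ≥0∞ :=
  ⨆ I : Instance, opt I / ENNReal.ofReal (alg I).profit

/-! ## The machine model

A random access machine with unit costs. Its memory consists of arrays of natural numbers (used
for indices and counters) and arrays of real numbers (used for profits, demands and sizes). Arrays
are named by numerals that are fixed in the program, and a scalar variable is an array that is used
at index `0` only. There are no operations between the two sorts, and there are no real constants
but `0`. Every elementary operation costs one unit of time: a constant, an array access, an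
addition, a subtraction, a comparison, an assignment, a branching.

The only use of multiplication is a comparison of two products, as needed for comparing ratios;
no product is ever stored. Hence the machine cannot build large numbers fast: in `t` units of time
the largest absolute value in the memory grows at most by a factor exponential in `t`, so on
integral input data all numbers have bit length polynomial in `t` and in the length of the data. -/

/-- A state of the memory: `idx a k` is the entry at `k` of the array `a` of natural numbers, and
`num a k` is the entry at `k` of the array `a` of real numbers. -/
structure State where
  idx : ℕ → ℕ → ℕ
  num : ℕ → ℕ → ℝ

/-- Expressions for natural numbers; `read a e` is the entry at `e` of the array `a`. -/
inductive IExpr where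
  | const (k : ℕ)
  | read (a : ℕ) (e : IExpr)
  | add (e f : IExpr)
  | sub (e f : IExpr)

/-- The value of an index expression; subtraction is truncated at `0`. -/
def IExpr.eval (σ : State) : IExpr → ℕ
  | const k => k
  | read a e => σ.idx a (e.eval σ)
  | add e f => e.eval σ + f.eval σ
  | sub e f => e.eval σ - f.eval σ

/-- The number of elementary operations in the evaluation of an index expression. -/
def IExpr.cost : IExpr → ℕ
  | const _ => 1
  | read _ e => e.cost + 1
  | add e f => e.cost + f.cost + 1
  | sub e f => e.cost + f.cost + 1

/-- Expressions for real numbers; `read a e` is the entry at `e` of the array `a`. -/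
inductive NExpr where
  | zero
  | read (a : ℕ) (e : IExpr)
  | add (x y : NExpr)
  | sub (x y : NExpr)

/-- The value of a real expression. -/
noncomputable def NExpr.eval (σ : State) : NExpr → ℝ
  | zero => 0
  | read a e => σ.num a (e.eval σ)
  | add x y => x.eval σ + y.eval σ
  | sub x y => x.eval σ - y.eval σ

/-- The number of elementary operations in the evaluation of a real expression. -/
def NExpr.cost : NExpr → ℕ
  | zero => 1
  | read _ e => e.cost + 1
  | add x y => x.cost + y.cost + 1
  | sub x y => x.cost + y.cost + 1

/-- The tests: a comparison of two indices, of two numbers, or of two products `x * y` and `z * w`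
of numbers. -/
inductive Test where
  | idxLe (e f : IExpr)
  | numLe (x y : NExpr)
  | mulLe (x y z w : NExpr)

/-- The condition that a test stands for. -/
def Test.Holds (σ : State) : Test → Prop
  | idxLe e f => e.eval σ ≤ f.eval σ
  | numLe x y => x.eval σ ≤ y.eval σ
  | mulLe x y z w => x.eval σ * y.eval σ ≤ z.eval σ * w.eval σ

/-- The number of elementary operations in the evaluation of a test. -/
def Test.cost : Test → ℕ
  | idxLe e f => e.cost + f.cost + 1
  | numLe x y => x.cost + y.cost + 1
  | mulLe x y z w => x.cost + y.cost + z.cost + w.cost + 3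

/-- Programs: assignments `a[e] := f` to index arrays, assignments `a[e] := x` to number arrays,
composition, branching and loops. -/
inductive Program where
  | skip
  | setIdx (a : ℕ) (e f : IExpr)
  | setNum (a : ℕ) (e : IExpr) (x : NExpr)
  | seq (P Q : Program)
  | ite (b : Test) (P Q : Program)
  | loop (b : Test) (P : Program)

/-- Overwrite the entry at `k` of the index array `a` by `v`. -/
def State.setIdx (σ : State) (a k v : ℕ) : State :=
  { σ with idx := fun a' k' => if a' = a ∧ k' = k then v else σ.idx a' k' }

/-- Overwrite the entry at `k` of the number array `a` by `v`. -/
def State.setNum (σ : State) (a k : ℕ) (v : ℝ) : State :=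
  { σ with num := fun a' k' => if a' = a ∧ k' = k then v else σ.num a' k' }

/-- `Exec P σ t τ`: started in the state `σ`, the program `P` halts after exactly `t` units of time
in the state `τ`. A program `P` that does not halt from `σ` satisfies this for no `t` and `τ`. -/
inductive Exec : Program → State → ℕ → State → Prop where
  | skip (σ : State) : Exec .skip σ 1 σ
  | setIdx (σ : State) (a : ℕ) (e f : IExpr) :
      Exec (.setIdx a e f) σ (e.cost + f.cost + 1) (σ.setIdx a (e.eval σ) (f.eval σ))
  | setNum (σ : State) (a : ℕ) (e : IExpr) (x : NExpr) :
      Exec (.setNum a e x) σ (e.cost + x.cost + 1) (σ.setNum a (e.eval σ) (x.eval σ))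
  | seq {P Q : Program} {σ τ υ : State} {t u : ℕ} :
      Exec P σ t τ → Exec Q τ u υ → Exec (.seq P Q) σ (t + u) υ
  | iteTrue {b : Test} {P Q : Program} {σ τ : State} {t : ℕ} :
      b.Holds σ → Exec P σ t τ → Exec (.ite b P Q) σ (b.cost + 1 + t) τ
  | iteFalse {b : Test} {P Q : Program} {σ τ : State} {t : ℕ} :
      ¬ b.Holds σ → Exec Q σ t τ → Exec (.ite b P Q) σ (b.cost + 1 + t) τ
  | loopTrue {b : Test} {P : Program} {σ τ υ : State} {t u : ℕ} :
      b.Holds σ → Exec P σ t τ → Exec (.loop b P) τ u υ →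
      Exec (.loop b P) σ (b.cost + 1 + t + u) υ
  | loopFalse {b : Test} {P : Program} {σ : State} :
      ¬ b.Holds σ → Exec (.loop b P) σ (b.cost + 1) σ

/-! ## Input and output -/

/-- The initial state for an instance: the index array `0` holds `m` and `n`, the number arrays
`0`, `1`, `2` hold the profits, the demands and the sizes, and everything else is `0`. -/
noncomputable def input (I : Instance) : State where
  idx a k := if a = 0 ∧ k = 0 then I.m else if a = 0 ∧ k = 1 then I.n else 0
  num a k :=
    if a = 0 then (if h : k < I.m then I.p ⟨k, h⟩ else 0)
    else if a = 1 then (if h : k < I.m then I.d ⟨k, h⟩ else 0)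
    else if a = 2 then (if h : k < I.n then I.s ⟨k, h⟩ else 0)
    else 0

/-- The solution that is read off a final state: item `j` is put into bin `i` (with bins counted
from `0`) if the entry at `j` of the index array `1` is `i + 1`; it stays unassigned if this entry
is the number of no bin. -/
def output (I : Instance) (σ : State) : Solution I where
  S i := {j | σ.idx 1 j = i + 1}
  disjoint i k hik := by
    rw [Finset.disjoint_left]
    intro j hj hj'
    simp only [Finset.mem_filter, Finset.mem_univ, true_and] at hj hj'
    exact hik (Fin.ext (by omega))

/-- The program `P` implements the algorithm `alg`, and its running time on instances with `m` bins
and `n` items is `O(f m n)`. The maximum with `1` matters only where `f m n < 1`. -/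
def ImplementsInTime (P : Program) (alg : (I : Instance) → Solution I) (f : ℕ → ℕ → ℝ) : Prop :=
  ∃ C : ℝ, ∀ I : Instance, ∃ (t : ℕ) (σ : State),
    Exec P (input I) t σ ∧ output I σ = alg I ∧ (t : ℝ) ≤ C * max 1 (f I.m I.n)

end GBC

/-!
The algorithm returns the best of three candidates.

* A greedy matching, of profit `w`: the bins are treated by decreasing profit, and each receives the
  smallest unused item that covers it alone. By exchange this is an optimal set of bins covered by
  one item each (`Run.matching_le`).
* A greedy cover, of profit `w'`: the bins are treated by decreasing density `p i / d i`, and each is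
  filled with unused items of size less than `d i` until it is covered; it is given up if these items
  do not suffice.
* The most profitable bin that can be covered by all items together, of profit `v`.

For any solution, let `B₁` be the covered bins that contain an item of size at least their demand,
and `B₂` the other covered bins. The profit of a bin in `B₂` is distributed over its items in
proportion to size. When the greedy cover covers a bin `k`, it uses items of size at most `2 * d k`,
and all bins still to come have at most the density of `k`, so that `3 * p k` pays for the profit lost
from `k` and from these items. When it gives up a bin `k` in `B₂`, the unused items of size less than
`d k` carry profit at most `p k`; discard them, too. Let `k₁, k₂, …` be the bins for which such items
existed. Their demands increase, and one of the items discarded for the next bin is at least as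
large as the demand of the bin before, so all of them but the last, which is worth at most `v`, can be
covered by one item each, with items that the solution uses in `B₂` (`Run.small_le`). Together with
the large items in `B₁` they form a matching, of profit at most `w`. Hence the optimum is at most
`w + 3 * w' + v` (`Solution.profit_le`), and the best candidate is worth at least a fifth of it.

A greedy algorithm with one round for each bin takes time `O(m * (m + n))`, which suffices if
`m < n * n`. If `n * n ≤ m`, each round first tests all bins and marks those that cannot be covered any
more. Then each round uses up an item, and the time is `O(n * (n * m))`, where `n ≤ √m`. Marking a bin
ahead of its turn is harmless: a bin that cannot be covered now cannot be covered later either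
(`Run.discard`).

Running times are bounded by a total-correctness calculus: `Reaches P σ T Q` says that `P` halts from
`σ` within time `T` in a state with `Q`. Loop-free programs are evaluated (`Reaches.run`), loops have
an invariant rule (`Reaches.for`), and arrays that a program does not mention as a target are
unchanged (`Reaches.frame`).
-/

namespace GBC

/-! ### Running times of programs -/


/-- Started in `σ`, the program `P` halts within `T` units of time in a state that satisfies `Q`. -/
def Reaches (P : Program) (σ : State) (T : ℕ) (Q : State → Prop) : Prop :=
  ∃ t τ, Exec P σ t τ ∧ t ≤ T ∧ Q τ

theorem Reaches.mono {P : Program} {σ : State} {T T' : ℕ} {Q Q' : State → Prop}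
    (h : Reaches P σ T Q) (hT : T ≤ T') (hQ : ∀ τ, Q τ → Q' τ) : Reaches P σ T' Q' := by
  obtain ⟨t, τ, h1, h2, h3⟩ := h
  exact ⟨t, τ, h1, h2.trans hT, hQ τ h3⟩

theorem Reaches.ite {b : Test} {P P' : Program} {σ : State} {T : ℕ} {Q : State → Prop}
    {T' : ℕ} (h : b.Holds σ → Reaches P σ T Q) (h' : ¬ b.Holds σ → Reaches P' σ T Q)
    (hT : b.cost + 1 + T ≤ T') : Reaches (.ite b P P') σ T' Q := by
  by_cases hb : b.Holds σ
  · obtain ⟨t, τ, h1, h2, h3⟩ := h hb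
    exact ⟨_, τ, .iteTrue hb h1, by omega, h3⟩
  · obtain ⟨t, τ, h1, h2, h3⟩ := h' hb
    exact ⟨_, τ, .iteFalse hb h1, by omega, h3⟩

theorem Test.holds_idxLe {σ : State} {e f : IExpr} :
    (Test.idxLe e f).Holds σ ↔ e.eval σ ≤ f.eval σ := Iff.rfl

theorem Test.cost_idxLe {e f : IExpr} : (Test.idxLe e f).cost = e.cost + f.cost + 1 := rfl

/-- Whether a program contains no loop. -/
def Program.loopFree : Program → Bool
  | seq P Q => P.loopFree && Q.loopFree
  | ite _ P Q => P.loopFree && Q.loopFree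
  | loop _ _ => false
  | _ => true

open Classical in
/-- The final state of a loop-free program; loops are treated as `skip`. -/
noncomputable def Program.run : Program → State → State
  | setIdx a e f, σ => σ.setIdx a (e.eval σ) (f.eval σ)
  | setNum a e x, σ => σ.setNum a (e.eval σ) (x.eval σ)
  | seq P Q, σ => Q.run (P.run σ)
  | ite b P Q, σ => if b.Holds σ then P.run σ else Q.run σ
  | _, σ => σ

/-- An upper bound for the running time of a loop-free program. -/
def Program.cost : Program → ℕ
  | skip => 1
  | setIdx _ e f => e.cost + f.cost + 1
  | setNum _ e x => e.cost + x.cost + 1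
  | seq P Q => P.cost + Q.cost
  | ite b P Q => b.cost + 1 + max P.cost Q.cost
  | loop _ _ => 0

theorem Reaches.run {P : Program} {σ : State} {T : ℕ} {Q : State → Prop}
    (hP : P.loopFree = true) (hT : P.cost ≤ T) (hQ : Q (P.run σ)) : Reaches P σ T Q := by
  refine Reaches.mono (T := P.cost) ?_ hT fun _ h => h
  clear hT
  induction P generalizing σ Q with
  | skip => exact ⟨_, _, .skip σ, le_rfl, hQ⟩
  | setIdx a e f => exact ⟨_, _, .setIdx σ a e f, le_rfl, hQ⟩
  | setNum a e x => exact ⟨_, _, .setNum σ a e x, le_rfl, hQ⟩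
  | seq P P' ih ih' =>
    simp only [Program.loopFree, Bool.and_eq_true] at hP
    obtain ⟨t, τ, h1, h2, u, υ, h3, h4, h5⟩ :=
      ih (Q := fun τ => Reaches P' τ P'.cost Q) hP.1 (ih' hP.2 hQ)
    exact ⟨t + u, υ, .seq h1 h3, by simp only [Program.cost]; omega, h5⟩
  | ite b P P' ih ih' =>
    simp only [Program.loopFree, Bool.and_eq_true] at hP
    simp only [Program.run] at hQ
    refine Reaches.ite (fun hb => ?_) (fun hb => ?_) le_rfl
    · rw [if_pos hb] at hQ
      exact (ih hP.1 hQ).mono (le_max_left _ _) fun _ h => h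
    · rw [if_neg hb] at hQ
      exact (ih' hP.2 hQ).mono (le_max_right _ _) fun _ h => h
  | loop b P => simp [Program.loopFree] at hP

/-- The index arrays that a program may write. -/
def Program.idxWrites : Program → List ℕ
  | setIdx a _ _ => [a]
  | seq P Q => P.idxWrites ++ Q.idxWrites
  | ite _ P Q => P.idxWrites ++ Q.idxWrites
  | loop _ P => P.idxWrites
  | _ => []

/-- The number arrays that a program may write. -/
def Program.numWrites : Program → List ℕ
  | setNum a _ _ => [a]
  | seq P Q => P.numWrites ++ Q.numWrites
  | ite _ P Q => P.numWrites ++ Q.numWrites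
  | loop _ P => P.numWrites
  | _ => []

theorem Exec.idx_eq {P : Program} {σ τ : State} {t a : ℕ} (h : Exec P σ t τ)
    (ha : a ∉ P.idxWrites) : τ.idx a = σ.idx a := by
  induction h with
  | skip | setNum | loopFalse => rfl
  | setIdx σ b e f =>
    funext k
    simp only [Program.idxWrites, List.mem_singleton] at ha
    simp [State.setIdx, ha]
  | seq _ _ ih ih' =>
    simp only [Program.idxWrites, List.mem_append, not_or] at ha
    rw [ih' ha.2, ih ha.1]
  | iteTrue _ _ ih =>
    simp only [Program.idxWrites, List.mem_append, not_or] at ha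
    exact ih ha.1
  | iteFalse _ _ ih =>
    simp only [Program.idxWrites, List.mem_append, not_or] at ha
    exact ih ha.2
  | loopTrue _ _ _ ih ih' => rw [ih' ha, ih ha]

theorem Exec.num_eq {P : Program} {σ τ : State} {t a : ℕ} (h : Exec P σ t τ)
    (ha : a ∉ P.numWrites) : τ.num a = σ.num a := by
  induction h with
  | skip | setIdx | loopFalse => rfl
  | setNum σ b e x =>
    funext k
    simp only [Program.numWrites, List.mem_singleton] at ha
    simp [State.setNum, ha]
  | seq _ _ ih ih' =>
    simp only [Program.numWrites, List.mem_append, not_or] at ha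
    rw [ih' ha.2, ih ha.1]
  | iteTrue _ _ ih =>
    simp only [Program.numWrites, List.mem_append, not_or] at ha
    exact ih ha.1
  | iteFalse _ _ ih =>
    simp only [Program.numWrites, List.mem_append, not_or] at ha
    exact ih ha.2
  | loopTrue _ _ _ ih ih' => rw [ih' ha, ih ha]

/-- The states `σ` and `τ` agree outside the arrays that `P` may write. -/
def Frame (P : Program) (σ τ : State) : Prop :=
  (∀ a, a ∉ P.idxWrites → τ.idx a = σ.idx a) ∧ ∀ a, a ∉ P.numWrites → τ.num a = σ.num a

theorem Reaches.frame {P : Program} {σ : State} {T : ℕ} {Q : State → Prop}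
    (h : Reaches P σ T Q) : Reaches P σ T fun τ => Frame P σ τ ∧ Q τ := by
  obtain ⟨t, τ, h1, h2, h3⟩ := h
  exact ⟨t, τ, h1, h2, ⟨fun _ => h1.idx_eq, fun _ => h1.num_eq⟩, h3⟩

/-- The scalar variable that is stored in the index array `a`. -/
abbrev ivar (a : ℕ) : IExpr := .read a (.const 0)

/-- The scalar variable that is stored in the number array `a`. -/
abbrev nvar (a : ℕ) : NExpr := .read a (.const 0)

/-- Assignment to the scalar variable in the index array `a`. -/
abbrev assign (a : ℕ) (e : IExpr) : Program := .setIdx a (.const 0) e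

/-- Assignment to the scalar variable in the number array `a`. -/
abbrev nassign (a : ℕ) (x : NExpr) : Program := .setNum a (.const 0) x

/-- The loop `for c = 0, …, e - 1 do P`. Its meaning is as intended only if `P` changes neither `c`
nor the value of `e`. -/
def Program.for (c : ℕ) (e : IExpr) (P : Program) : Program :=
  .seq (assign c (.const 0))
    (.loop (.idxLe (.add (ivar c) (.const 1)) e)
      (.seq P (assign c (.add (ivar c) (.const 1)))))

theorem Reaches.bind {P P' : Program} {σ : State} {T₁ T₂ T : ℕ} {R Q : State → Prop}
    (h : Reaches P σ T₁ R) (h' : ∀ τ, Frame P σ τ → R τ → Reaches P' τ T₂ Q) (hT : T₁ + T₂ ≤ T) :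
    Reaches (.seq P P') σ T Q := by
  obtain ⟨t, τ, h1, h2, hF, hR⟩ := h.frame
  obtain ⟨u, υ, h3, h4, h5⟩ := h' τ hF hR
  exact ⟨t + u, υ, .seq h1 h3, by omega, h5⟩

theorem Reaches.cons {P P' : Program} {σ : State} {T T' : ℕ} {Q : State → Prop}
    (hP : P.loopFree = true) (h : ∀ τ, Frame P σ τ → τ = P.run σ → Reaches P' τ T' Q)
    (hT : P.cost + T' ≤ T) : Reaches (.seq P P') σ T Q :=
  .bind (.run (Q := (· = P.run σ)) hP le_rfl rfl) h hT

theorem Frame.refl (P : Program) (σ : State) : Frame P σ σ :=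
  ⟨fun _ _ => rfl, fun _ _ => rfl⟩

theorem Frame.trans {P : Program} {σ τ υ : State} (h : Frame P σ τ) (h' : Frame P τ υ) :
    Frame P σ υ :=
  ⟨fun a ha => (h'.1 a ha).trans (h.1 a ha), fun a ha => (h'.2 a ha).trans (h.2 a ha)⟩

@[simp] theorem State.setIdx_idx_self (σ : State) (a k v : ℕ) :
    (σ.setIdx a k v).idx a = Function.update (σ.idx a) k v := by
  funext l
  simp [State.setIdx, Function.update_apply]

@[simp] theorem State.setIdx_idx_of_ne (σ : State) {a b : ℕ} (k v : ℕ) (h : b ≠ a) :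
    (σ.setIdx a k v).idx b = σ.idx b := by
  funext l
  simp [State.setIdx, h]

@[simp] theorem State.setIdx_num (σ : State) (a k v : ℕ) : (σ.setIdx a k v).num = σ.num := rfl

@[simp] theorem State.setNum_num_self (σ : State) (a k : ℕ) (v : ℝ) :
    (σ.setNum a k v).num a = Function.update (σ.num a) k v := by
  funext l
  simp [State.setNum, Function.update_apply]

@[simp] theorem State.setNum_idx (σ : State) (a k : ℕ) (v : ℝ) :
    (σ.setNum a k v).idx = σ.idx := rfl

/-- The rule for `Program.for`, with an invariant `Inv k` at the start of the round `k`. That only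
the arrays written by the loop change need not be part of the invariant. -/
theorem Reaches.for {c : ℕ} {e : IExpr} {P : Program} {σ : State} {N : ℕ}
    (T : ℕ) (Inv : ℕ → State → Prop) (hc : c ∉ P.idxWrites)
    (he : ∀ τ, Frame (.for c e P) σ τ → e.eval τ = N) (h0 : Inv 0 (σ.setIdx c 0 0))
    (step : ∀ k τ, k < N → Frame (.for c e P) σ τ → τ.idx c 0 = k → Inv k τ →
      Reaches P τ T fun υ => Inv (k + 1) (υ.setIdx c 0 (k + 1))) :
    Reaches (.for c e P) σ (N * (T + e.cost + 12) + e.cost + 9)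
      fun τ => Frame (.for c e P) σ τ ∧ Inv N τ := by
  have hset : ∀ τ v, Frame (.for c e P) σ τ → Frame (.for c e P) σ (τ.setIdx c 0 v) := by
    refine fun τ v h => h.trans ⟨fun a ha => State.setIdx_idx_of_ne _ _ _ ?_, fun _ _ => rfl⟩
    rintro rfl
    simp [Program.for, Program.idxWrites] at ha
  have hP : ∀ τ υ, Frame P τ υ → Frame (.for c e P) τ υ := by
    refine fun τ υ h => ⟨fun a ha => h.1 a fun ha' => ha ?_, fun a ha => h.2 a fun ha' => ha ?_⟩
    · simp [Program.for, Program.idxWrites, ha']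
    · simpa [Program.for, Program.numWrites] using ha'
  have main : ∀ r k τ, k + r = N → Frame (.for c e P) σ τ → τ.idx c 0 = k → Inv k τ →
      Reaches (.loop (.idxLe (.add (ivar c) (.const 1)) e)
        (.seq P (assign c (.add (ivar c) (.const 1))))) τ (r * (T + e.cost + 12) + e.cost + 6)
        fun τ => Frame (.for c e P) σ τ ∧ Inv N τ := by
    intro r
    induction r with
    | zero =>
      intro k τ hk hF hck hI
      have hb : ¬ (Test.idxLe (.add (ivar c) (.const 1)) e).Holds τ := by
        simp only [Test.Holds, IExpr.eval, he τ hF, hck]; omega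
      refine ⟨_, τ, .loopFalse hb, ?_, hF, ?_⟩
      · simp only [Test.cost, IExpr.cost]; omega
      · obtain rfl : k = N := by omega
        exact hI
    | succ r ih =>
      intro k τ hk hF hck hI
      have hb : (Test.idxLe (.add (ivar c) (.const 1)) e).Holds τ := by
        simp only [Test.Holds, IExpr.eval, he τ hF, hck]; omega
      obtain ⟨t, υ, h1, h2, hF', h3⟩ := (step k τ (by omega) hF hck hI).frame
      have hcυ : υ.idx c 0 = k := by rw [h1.idx_eq hc, hck]
      obtain ⟨u, ω, h4, h5, h6⟩ := ih (k + 1) (υ.setIdx c 0 (k + 1)) (by omega)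
        (hset _ _ (hF.trans (hP _ _ hF'))) (by simp) h3
      have h7 := Exec.setIdx υ c (.const 0) (.add (ivar c) (.const 1))
      simp only [IExpr.eval, hcυ] at h7
      refine ⟨_, ω, .loopTrue hb (.seq h1 h7) h4, ?_, h6⟩
      simp only [Test.cost, IExpr.cost]
      ring_nf at h5 ⊢
      omega
  obtain ⟨t, τ, h1, h2, h3⟩ := main N 0 (σ.setIdx c 0 0) (by omega) (hset _ _ (.refl _ _))
    (by simp) h0
  refine ⟨_, τ, .seq (Exec.setIdx σ c (.const 0) (.const 0)) h1, ?_, h3⟩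
  simp only [IExpr.cost]
  omega

/-- A loop that writes the value of `f` at the time `k` to the entry at `k` of the array `a`. -/
theorem Reaches.fill {a c : ℕ} {e f : IExpr} {σ : State} {N : ℕ} (v : ℕ → ℕ) (hca : c ≠ a)
    (he : ∀ τ, Frame (.for c e (.setIdx a (ivar c) f)) σ τ → e.eval τ = N)
    (hf : ∀ k τ, Frame (.for c e (.setIdx a (ivar c) f)) σ τ → τ.idx c 0 = k → f.eval τ = v k) :
    Reaches (.for c e (.setIdx a (ivar c) f)) σ (N * (f.cost + e.cost + 15) + e.cost + 9)
      fun τ => ∀ k < N, τ.idx a k = v k := by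
  refine (Reaches.for (f.cost + 3) (fun k τ => ∀ l < k, τ.idx a l = v l)
    (by simpa [Program.idxWrites] using hca) he (by simp) ?_).mono (by ring_nf; omega) fun _ h => h.2
  intro k τ hk hF hck hI
  refine Reaches.run rfl (by simp only [Program.cost, IExpr.cost]; omega) ?_
  intro l hl
  simp only [Program.run, IExpr.eval, State.setIdx_idx_of_ne _ _ _ hca.symm,
    State.setIdx_idx_self, hck, hf k τ hF hck, Function.update_apply]
  split_ifs with hlk
  · rw [hlk]
  · exact hI l (by omega)

/-! ### Runs of greedy algorithms -/


variable {I : Instance}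

/-- A run of a greedy algorithm that treats the bins by decreasing key `κ`. A state consists of the
set `L` of the bins that are still to be treated, the set `U` of the unused items, and the profit
`w` collected so far. A bin `k` is either covered by a set `G` of unused items with `Take U k G`, or
given up, which is allowed only if `Viable U k` fails. -/
inductive Run (I : Instance) (κ : Fin I.m → ℝ) (Viable : Finset (Fin I.n) → Fin I.m → Prop)
    (Take : Finset (Fin I.n) → Fin I.m → Finset (Fin I.n) → Prop) :
    Finset (Fin I.m) → Finset (Fin I.n) → ℝ → Prop
  | start : Run I κ Viable Take Finset.univ Finset.univ 0
  | take {L U w k G} : Run I κ Viable Take L U w → k ∈ L → (∀ i ∈ L, κ i ≤ κ k) → Take U k G →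
      Run I κ Viable Take (L.erase k) (U \ G) (w + I.p k)
  | fail {L U w k} : Run I κ Viable Take L U w → k ∈ L → (∀ i ∈ L, κ i ≤ κ k) → ¬ Viable U k →
      Run I κ Viable Take (L.erase k) U w

/-- If the bins in `L' \ L` are not viable, then they may be given up, by decreasing key, until no
remaining key exceeds the bound `x` for the keys in `L`. For `x = ⊥` no bin remains. -/
theorem Run.discard {κ : Fin I.m → ℝ} {Viable : Finset (Fin I.n) → Fin I.m → Prop}
    {Take : Finset (Fin I.n) → Fin I.m → Finset (Fin I.n) → Prop} {L L' : Finset (Fin I.m)}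
    {U : Finset (Fin I.n)} {w : ℝ} (x : WithBot ℝ) (hL : ∀ i ∈ L, (κ i : WithBot ℝ) ≤ x)
    (h : Run I κ Viable Take L' U w) (hLL : L ⊆ L') (hv : ∀ q ∈ L', q ∉ L → ¬ Viable U q) :
    ∃ L'' ⊆ L', L ⊆ L'' ∧ Run I κ Viable Take L'' U w ∧ ∀ i ∈ L'', (κ i : WithBot ℝ) ≤ x := by
  induction hc : L'.card generalizing L' with
  | zero =>
    rw [Finset.card_eq_zero] at hc
    exact ⟨L', subset_rfl, hLL, h, by simp [hc]⟩
  | succ c ih =>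
    have hne : L'.Nonempty := Finset.card_pos.1 (by omega)
    obtain ⟨q, hq, hmax⟩ := Finset.exists_max_image L' κ hne
    by_cases hqx : (κ q : WithBot ℝ) ≤ x
    · exact ⟨L', subset_rfl, hLL, h,
        fun i hi => (WithBot.coe_le_coe.2 (hmax i hi)).trans hqx⟩
    · -- The bin `q` beats all bins in `L`, hence it is one of those to be given up.
      have hqL : q ∉ L := fun hqL => hqx (hL q hqL)
      obtain ⟨L'', h1, h2, h3, h4⟩ := ih (h.fail hq hmax (hv q hq hqL))
        (fun i hi => Finset.mem_erase.2 ⟨fun e => hqL (e ▸ hi), hLL hi⟩)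
        (fun i hi hi' => hv i (Finset.mem_of_mem_erase hi) hi')
        (by rw [Finset.card_erase_of_mem hq, hc]; rfl)
      exact ⟨L'', h1.trans (Finset.erase_subset _ _), h2, h3, h4⟩

/-! ### Bins covered by a single large item -/

/-- Some item in `U` covers the bin `k` alone. -/
def LargeViable (I : Instance) (U : Finset (Fin I.n)) (k : Fin I.m) : Prop := ∃ j ∈ U, I.d k ≤ I.s j

/-- The set `G` consists of a smallest item in `U` that covers the bin `k` alone. -/
def LargeTake (I : Instance) (U : Finset (Fin I.n)) (k : Fin I.m) (G : Finset (Fin I.n)) : Prop :=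
  ∃ j ∈ U, I.d k ≤ I.s j ∧ (∀ j' ∈ U, I.d k ≤ I.s j' → I.s j ≤ I.s j') ∧ G = {j}

/-- Each bin `i ∈ B` can be covered by its own item `f i ∈ U` alone. -/
structure IsMatching (I : Instance) (U : Finset (Fin I.n)) (B : Finset (Fin I.m))
    (f : Fin I.m → Fin I.n) : Prop where
  inj : Set.InjOn f B
  mem : ∀ i ∈ B, f i ∈ U
  le : ∀ i ∈ B, I.d i ≤ I.s (f i)

theorem IsMatching.subset {U : Finset (Fin I.n)} {B B' : Finset (Fin I.m)} {f : Fin I.m → Fin I.n}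
    (h : IsMatching I U B f) (hB : B' ⊆ B) : IsMatching I U B' f :=
  ⟨h.inj.mono (by exact_mod_cast hB), fun i hi => h.mem i (hB hi), fun i hi => h.le i (hB hi)⟩

/-- The exchange step: after the greedy choice of `j` for `k`, a matching of the remaining bins and
items loses at most the profit of `k`. -/
theorem IsMatching.exchange {L : Finset (Fin I.m)} {U : Finset (Fin I.n)} {k : Fin I.m}
    {j : Fin I.n} (hmax : ∀ i ∈ L, I.p i ≤ I.p k)
    (hmin : ∀ j' ∈ U, I.d k ≤ I.s j' → I.s j ≤ I.s j')
    {B : Finset (Fin I.m)} {f : Fin I.m → Fin I.n} (hB : B ⊆ L) (h : IsMatching I U B f) :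
    ∃ B' ⊆ L.erase k, ∃ f', IsMatching I (U \ {j}) B' f' ∧
      ∑ i ∈ B, I.p i ≤ I.p k + ∑ i ∈ B', I.p i := by
  have herase : B.erase k ⊆ L.erase k := Finset.erase_subset_erase k hB
  by_cases hj : ∃ i ∈ B, f i = j
  · obtain ⟨i, hi, hij⟩ := hj
    have hne : ∀ x ∈ B, x ≠ i → f x ≠ j := fun x hx hxi e => hxi (h.inj hx hi (e.trans hij.symm))
    by_cases hk : k ∈ B
    · by_cases hik : i = k
      · subst hik
        refine ⟨B.erase i, herase, f, ⟨?_, ?_, ?_⟩, (Finset.add_sum_erase B I.p hk).ge⟩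
        · exact (h.subset (Finset.erase_subset _ _)).inj
        · intro x hx
          rw [Finset.mem_erase] at hx
          simp [h.mem x hx.2, hne x hx.2 hx.1]
        · exact fun x hx => h.le x (Finset.mem_of_mem_erase hx)
      · -- `i` holds `j`, and `k` holds a larger item, which is handed over to `i`.
        have hle : I.s j ≤ I.s (f k) := hmin _ (h.mem k hk) (h.le k hk)
        have hkj : f k ≠ j := hne k hk (Ne.symm hik)
        refine ⟨B.erase k, herase, Function.update f i (f k), ⟨?_, ?_, ?_⟩,
          (Finset.add_sum_erase B I.p hk).ge⟩
        · intro x hx y hy hxy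
          simp only [Finset.coe_erase, Set.mem_sdiff, Finset.mem_coe, Set.mem_singleton_iff]
            at hx hy
          by_cases hxi : x = i <;> by_cases hyi : y = i
          · rw [hxi, hyi]
          · rw [hxi, Function.update_self, Function.update_of_ne hyi] at hxy
            exact absurd (h.inj hk hy.1 hxy) (Ne.symm hy.2)
          · rw [hyi, Function.update_self, Function.update_of_ne hxi] at hxy
            exact absurd (h.inj hx.1 hk hxy) hx.2
          · rw [Function.update_of_ne hyi, Function.update_of_ne hxi] at hxy
            exact h.inj hx.1 hy.1 hxy
        · intro x hx
          rw [Finset.mem_erase] at hx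
          by_cases hxi : x = i
          · subst hxi; simp [h.mem k hk, hkj]
          · simp [Function.update_of_ne hxi, h.mem x hx.2, hne x hx.2 hxi]
        · intro x hx
          rw [Finset.mem_erase] at hx
          by_cases hxi : x = i
          · subst hxi
            have := h.le x hi
            rw [hij] at this
            simpa using this.trans hle
          · simpa [Function.update_of_ne hxi] using h.le x hx.2
    · refine ⟨B.erase i, fun x hx => ?_, f, ⟨?_, ?_, ?_⟩, ?_⟩
      · rw [Finset.mem_erase] at hx ⊢
        exact ⟨fun e => hk (e ▸ hx.2), hB hx.2⟩
      · exact (h.subset (Finset.erase_subset _ _)).inj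
      · intro x hx
        rw [Finset.mem_erase] at hx
        simp [h.mem x hx.2, hne x hx.2 hx.1]
      · exact fun x hx => h.le x (Finset.mem_of_mem_erase hx)
      · rw [← Finset.add_sum_erase B I.p hi]
        have := hmax i (hB hi)
        linarith
  · push Not at hj
    refine ⟨B.erase k, herase, f, ⟨?_, ?_, ?_⟩, ?_⟩
    · exact (h.subset (Finset.erase_subset _ _)).inj
    · intro x hx
      rw [Finset.mem_erase] at hx
      simp [h.mem x hx.2, hj x hx.2]
    · exact fun x hx => h.le x (Finset.mem_of_mem_erase hx)
    · by_cases hk : k ∈ B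
      · exact (Finset.add_sum_erase B I.p hk).ge
      · rw [Finset.erase_eq_of_notMem hk]
        have := I.p_nonneg k
        linarith

/-- The large-item greedy loses nothing: a matching of all bins is worth at most the profit collected
so far and some matching of the remaining bins and items. -/
theorem Run.exists_isMatching {L : Finset (Fin I.m)} {U : Finset (Fin I.n)} {w : ℝ}
    (h : Run I I.p (LargeViable I) (LargeTake I) L U w) {B : Finset (Fin I.m)}
    {f : Fin I.m → Fin I.n} (hf : IsMatching I Finset.univ B f) :
    ∃ B' ⊆ L, ∃ f', IsMatching I U B' f' ∧ ∑ i ∈ B, I.p i ≤ w + ∑ i ∈ B', I.p i := by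
  induction h with
  | start => exact ⟨B, Finset.subset_univ _, f, hf, by simp⟩
  | take _ _ hmax hG ih =>
    obtain ⟨B', hB', f', hf', hle⟩ := ih
    obtain ⟨j, _, _, hmin, rfl⟩ := hG
    obtain ⟨B'', hB'', f'', hf'', hle'⟩ := hf'.exchange hmax hmin hB'
    exact ⟨B'', hB'', f'', hf'', by linarith⟩
  | fail _ _ _ hv ih =>
    obtain ⟨B', hB', f', hf', hle⟩ := ih
    refine ⟨B', fun x hx => Finset.mem_erase.2 ⟨?_, hB' hx⟩, f', hf', hle⟩
    rintro rfl
    exact hv ⟨f' x, hf'.mem x hx, hf'.le x hx⟩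

/-- A finished run for large items collects at least the profit of every matching. -/
theorem Run.matching_le {L : Finset (Fin I.m)} {U : Finset (Fin I.n)} {w : ℝ}
    (h : Run I I.p (LargeViable I) (LargeTake I) L U w) (hend : L = ∅ ∨ U = ∅)
    {B : Finset (Fin I.m)} {f : Fin I.m → Fin I.n} (hf : IsMatching I Finset.univ B f) :
    ∑ i ∈ B, I.p i ≤ w := by
  obtain ⟨B', hB', f', hf', hle⟩ := h.exists_isMatching hf
  have : B' = ∅ := by
    rcases hend with rfl | rfl
    · exact Finset.subset_empty.1 hB'
    · exact Finset.eq_empty_of_forall_notMem fun i hi => by simpa using hf'.mem i hi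
  simpa [this] using hle

/-! ### Bins covered by small items -/

/-- The items in `U` that do not cover the bin `k` alone suffice together to cover it. -/
def SmallViable (I : Instance) (U : Finset (Fin I.n)) (k : Fin I.m) : Prop :=
  I.d k ≤ I.size {j ∈ U | I.s j < I.d k}

/-- The set `G` consists of items in `U` none of which covers the bin `k` alone; together they cover
it, with a total size of at most twice its demand. -/
structure SmallTake (I : Instance) (U : Finset (Fin I.n)) (k : Fin I.m) (G : Finset (Fin I.n)) :
    Prop where
  subset : G ⊆ U
  lt : ∀ j ∈ G, I.s j < I.d k
  covers : I.d k ≤ I.size G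
  size_le : I.size G ≤ 2 * I.d k

theorem Instance.size_mono {K K' : Finset (Fin I.n)} (h : K ⊆ K') : I.size K ≤ I.size K' :=
  Finset.sum_le_sum_of_subset_of_nonneg h fun j _ _ => I.s_nonneg j

theorem Instance.size_nonneg (K : Finset (Fin I.n)) : 0 ≤ I.size K :=
  Finset.sum_nonneg fun j _ => I.s_nonneg j

/-- The part of the profit of the bin `i` that the items in `U` of size at least `θ` contribute, if
`K` is meant to cover `i` and the profit is distributed in proportion to size. -/
noncomputable def share (I : Instance) (K U : Finset (Fin I.n)) (θ : ℝ) (i : Fin I.m) : ℝ :=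
  I.p i / I.d i * min (I.d i) (I.size {j ∈ K ∩ U | θ ≤ I.s j})

theorem density_nonneg (i : Fin I.m) : 0 ≤ I.p i / I.d i :=
  div_nonneg (I.p_nonneg i) (I.d_pos i).le

theorem share_nonneg (K U : Finset (Fin I.n)) (θ : ℝ) (i : Fin I.m) : 0 ≤ share I K U θ i :=
  mul_nonneg (density_nonneg i) (le_min (I.d_pos i).le (Instance.size_nonneg _))

theorem share_le (K U : Finset (Fin I.n)) (θ : ℝ) (i : Fin I.m) : share I K U θ i ≤ I.p i := by
  calc share I K U θ i ≤ I.p i / I.d i * I.d i :=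
        mul_le_mul_of_nonneg_left (min_le_left _ _) (density_nonneg i)
    _ = I.p i := div_mul_cancel₀ _ (I.d_pos i).ne'

theorem share_eq_zero {K U : Finset (Fin I.n)} {θ : ℝ} {i : Fin I.m}
    (h : ∀ j ∈ K, j ∈ U → ¬ θ ≤ I.s j) : share I K U θ i = 0 := by
  have : ({j ∈ K ∩ U | θ ≤ I.s j} : Finset (Fin I.n)) = ∅ :=
    Finset.filter_eq_empty_iff.2 fun {j} hj => h j (Finset.mem_inter.1 hj).1 (Finset.mem_inter.1 hj).2
  simp [share, this, Instance.size, (I.d_pos i).le]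

/-- If the items that no longer contribute lie in `R`, then the share drops by at most the density
times the size of `R`. -/
theorem share_le_add {K U U' R : Finset (Fin I.n)} {θ θ' : ℝ} {i : Fin I.m}
    (h : ∀ j ∈ K, j ∈ U → θ ≤ I.s j → (j ∈ U' ∧ θ' ≤ I.s j) ∨ j ∈ R) :
    share I K U θ i ≤ share I K U' θ' i + I.p i / I.d i * I.size (K ∩ R) := by
  rw [share, share, ← mul_add]
  refine mul_le_mul_of_nonneg_left ?_ (density_nonneg i)
  have h1 : I.size {j ∈ K ∩ U | θ ≤ I.s j} ≤
      I.size {j ∈ K ∩ U' | θ' ≤ I.s j} + I.size (K ∩ R) := by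
    refine (Instance.size_mono (K' := {j ∈ K ∩ U' | θ' ≤ I.s j} ∪ K ∩ R) fun j hj => ?_).trans ?_
    · simp only [Finset.mem_filter, Finset.mem_inter, Finset.mem_union] at hj ⊢
      rcases h j hj.1.1 hj.1.2 hj.2 with h | h
      · exact Or.inl ⟨⟨hj.1.1, h.1⟩, h.2⟩
      · exact Or.inr ⟨hj.1.1, h⟩
    · have := Finset.sum_union_inter (s₁ := {j ∈ K ∩ U' | θ' ≤ I.s j}) (s₂ := K ∩ R) (f := I.s)
      have h2 := Instance.size_nonneg (I := I) ({j ∈ K ∩ U' | θ' ≤ I.s j} ∩ (K ∩ R))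
      simp only [Instance.size] at *
      linarith
  have h2 := Instance.size_nonneg (I := I) (K ∩ R)
  rcases le_total (I.d i) (I.size {j ∈ K ∩ U' | θ' ≤ I.s j}) with h3 | h3
  · rw [min_eq_left h3]
    exact (min_le_left _ _).trans (by linarith)
  · rw [min_eq_right h3]
    exact (min_le_right _ _).trans h1

/-- Pairwise disjoint sets of items, weighted by densities of at most `ρ`. -/
theorem sum_density_mul_size_le {B : Finset (Fin I.m)} {K : Fin I.m → Finset (Fin I.n)}
    (hK : ∀ i k, i ≠ k → Disjoint (K i) (K k)) {ρ : ℝ} (hρ : 0 ≤ ρ)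
    (hB : ∀ i ∈ B, I.p i / I.d i ≤ ρ) (R : Finset (Fin I.n)) :
    ∑ i ∈ B, I.p i / I.d i * I.size (K i ∩ R) ≤ ρ * I.size R := by
  calc ∑ i ∈ B, I.p i / I.d i * I.size (K i ∩ R) ≤ ∑ i ∈ B, ρ * I.size (K i ∩ R) :=
        Finset.sum_le_sum fun i hi =>
          mul_le_mul_of_nonneg_right (hB i hi) (Instance.size_nonneg _)
    _ = ρ * I.size (B.biUnion fun i => K i ∩ R) := by
        rw [← Finset.mul_sum, Instance.size, Finset.sum_biUnion]
        · rfl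
        · intro i _ k _ hik
          exact (hK i k hik).mono Finset.inter_subset_left Finset.inter_subset_left
    _ ≤ ρ * I.size R := by
        refine mul_le_mul_of_nonneg_left (Instance.size_mono ?_) hρ
        simp

/-- The state of the accounting for a family of sets `K i`, `i ∈ B`, that cover the bins in `B` by
small items. The profit of `B` is paid by `3 * w`, by the bins in `H`, each of which is covered by
its own item `e q` alone, by the amount `c`, which is at most the profit of a single bin in `B`, and
by the shares of the remaining bins. Only items of size at least `θ` count in the shares, and the
items `e q` are smaller, so that new items can be chosen. -/
structure Account (I : Instance) (B : Finset (Fin I.m)) (K : Fin I.m → Finset (Fin I.n))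
    (L : Finset (Fin I.m)) (U : Finset (Fin I.n)) (w : ℝ) (H : Finset (Fin I.m))
    (e : Fin I.m → Fin I.n) (c θ : ℝ) : Prop where
  subset : H ⊆ B
  notMem : ∀ q ∈ H, q ∉ L
  inj : Set.InjOn e H
  mem : ∀ q ∈ H, ∃ i ∈ B, e q ∈ K i
  le : ∀ q ∈ H, I.d q ≤ I.s (e q)
  lt : ∀ q ∈ H, I.s (e q) < θ
  last : c = 0 ∨ ∃ q ∈ B, q ∉ H ∧ q ∉ L ∧ I.d q ≤ θ ∧ c = I.p q
  bound : ∑ i ∈ B, I.p i ≤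
    3 * w + ∑ q ∈ H, I.p q + c + ∑ i ∈ B with i ∈ L, share I (K i) U θ i

/-- Covering `k` costs `3 * p k` of the shares: the share of `k` itself is at most `p k`, and the
items in `G`, of size at most `2 * d k`, contribute to other bins at a density of at most that of
`k`. -/
theorem Account.take {B : Finset (Fin I.m)} {K : Fin I.m → Finset (Fin I.n)}
    {L : Finset (Fin I.m)} {U : Finset (Fin I.n)} {w : ℝ} {H : Finset (Fin I.m)}
    {e : Fin I.m → Fin I.n} {c θ : ℝ} (h : Account I B K L U w H e c θ)
    (hK : ∀ i k, i ≠ k → Disjoint (K i) (K k)) {k : Fin I.m} {G : Finset (Fin I.n)}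
    (hmax : ∀ i ∈ L, I.p i / I.d i ≤ I.p k / I.d k) (hG : SmallTake I U k G) :
    Account I B K (L.erase k) (U \ G) (w + I.p k) H e c θ := by
  refine ⟨h.subset, fun q hq hq' => h.notMem q hq (Finset.mem_of_mem_erase hq'), h.inj, h.mem,
    h.le, h.lt, ?_, ?_⟩
  · rcases h.last with hc | ⟨q, h1, h2, h3, h4⟩
    · exact Or.inl hc
    · exact Or.inr ⟨q, h1, h2, fun hq' => h3 (Finset.mem_of_mem_erase hq'), h4⟩
  · have h1 : ∑ i ∈ B with i ∈ L, share I (K i) U θ i ≤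
        ∑ i ∈ B with i ∈ L, share I (K i) (U \ G) θ i + 2 * I.p k := by
      calc _ ≤ ∑ i ∈ B with i ∈ L,
            (share I (K i) (U \ G) θ i + I.p i / I.d i * I.size (K i ∩ G)) := by
            refine Finset.sum_le_sum fun i _ => share_le_add fun j _ hj hj' => ?_
            by_cases hjG : j ∈ G
            · exact Or.inr hjG
            · exact Or.inl ⟨Finset.mem_sdiff.2 ⟨hj, hjG⟩, hj'⟩
        _ ≤ ∑ i ∈ B with i ∈ L, share I (K i) (U \ G) θ i + I.p k / I.d k * I.size G := by
            rw [Finset.sum_add_distrib]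
            exact add_le_add_right (sum_density_mul_size_le hK (density_nonneg k)
              (fun i hi => hmax i (Finset.mem_filter.1 hi).2) G) _
        _ ≤ _ := by
            have h2 := mul_le_mul_of_nonneg_left hG.size_le (density_nonneg k)
            have h3 : I.p k / I.d k * (2 * I.d k) = 2 * I.p k := by
              have := (I.d_pos k).ne'
              field_simp
            linarith
    have h2 : ∑ i ∈ B with i ∈ L, share I (K i) (U \ G) θ i ≤
        ∑ i ∈ B with i ∈ L.erase k, share I (K i) (U \ G) θ i + I.p k := by
      have hsub : ({i ∈ B | i ∈ L} : Finset _) ⊆ insert k {i ∈ B | i ∈ L.erase k} := by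
        intro i hi
        simp only [Finset.mem_filter, Finset.mem_insert, Finset.mem_erase] at hi ⊢
        tauto
      have h3 := Finset.sum_le_sum_of_subset_of_nonneg hsub
        fun i _ _ => share_nonneg (K i) (U \ G) θ i
      rw [Finset.sum_insert (by simp)] at h3
      linarith [share_le (K k) (U \ G) θ k]
    linarith [h.bound]

/-- Suppose that `k` is given up. If `k ∈ B`, and some unused item of the family has a size between
`θ` and `d k`, then the threshold rises to `d k`. The shares drop by at most `p k`, since the unused
items below `d k` do not suffice to cover `k`. This drop is the new amount `c`; the bin responsible for
the old amount moves to `H`, with the item between the thresholds. Otherwise no share is lost. -/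
theorem Account.fail {B : Finset (Fin I.m)} {K : Fin I.m → Finset (Fin I.n)}
    {L : Finset (Fin I.m)} {U : Finset (Fin I.n)} {w : ℝ} {H : Finset (Fin I.m)}
    {e : Fin I.m → Fin I.n} {c θ : ℝ} (h : Account I B K L U w H e c θ)
    (hK : ∀ i k, i ≠ k → Disjoint (K i) (K k)) (hsmall : ∀ i ∈ B, ∀ j ∈ K i, I.s j < I.d i)
    {k : Fin I.m} (hk : k ∈ L) (hmax : ∀ i ∈ L, I.p i / I.d i ≤ I.p k / I.d k)
    (hv : ¬ SmallViable I U k) :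
    ∃ H e c θ, Account I B K (L.erase k) U w H e c θ := by
  have hL : ∀ q, q ∉ L → q ∉ L.erase k := fun q hq hq' => hq (Finset.mem_of_mem_erase hq')
  -- Dropping a bin without share.
  have drop : ∀ θ', (k ∈ B → share I (K k) U θ' k = 0) →
      ∑ i ∈ B with i ∈ L, share I (K i) U θ' i =
        ∑ i ∈ B with i ∈ L.erase k, share I (K i) U θ' i := by
    intro θ' h0
    symm
    refine Finset.sum_subset (fun i hi => ?_) fun i hi hi' => ?_
    · simp only [Finset.mem_filter, Finset.mem_erase] at hi ⊢
      tauto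
    · simp only [Finset.mem_filter, Finset.mem_erase] at hi hi'
      obtain rfl : i = k := by tauto
      exact h0 hi.1
  by_cases hex : k ∈ B ∧ ∃ j ∈ U, θ ≤ I.s j ∧ I.s j < I.d k ∧ ∃ i ∈ B, j ∈ K i
  · -- The item `j` covers the bin of the old amount `c`, as `j` has size at least `θ`.
    obtain ⟨hkB, j, hjU, hθj, hjk, hjK⟩ := hex
    have hθ : θ ≤ I.d k := hθj.trans hjk.le
    have hkH : k ∉ H := fun hkH => h.notMem k hkH hk
    have hej : ∀ q ∈ H, e q ≠ j := fun q hq he => by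
      have := h.lt q hq
      rw [he] at this
      linarith
    have hshare : ∑ i ∈ B with i ∈ L, share I (K i) U θ i ≤
        I.p k + ∑ i ∈ B with i ∈ L.erase k, share I (K i) U (I.d k) i := by
      -- All items in `K k` are below the new threshold, so `k` has no share any more.
      rw [← drop (I.d k) fun _ => share_eq_zero fun j hj _ => not_le.2 (hsmall k hkB j hj)]
      calc _ ≤ ∑ i ∈ B with i ∈ L, (share I (K i) U (I.d k) i +
              I.p i / I.d i * I.size (K i ∩ {j ∈ U | I.s j < I.d k})) := by
            refine Finset.sum_le_sum fun i _ => share_le_add fun j _ hj _ => ?_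
            rcases le_or_gt (I.d k) (I.s j) with hd | hd
            · exact Or.inl ⟨hj, hd⟩
            · exact Or.inr (Finset.mem_filter.2 ⟨hj, hd⟩)
        _ ≤ ∑ i ∈ B with i ∈ L, share I (K i) U (I.d k) i +
              I.p k / I.d k * I.size {j ∈ U | I.s j < I.d k} := by
            rw [Finset.sum_add_distrib]
            exact add_le_add_right (sum_density_mul_size_le hK (density_nonneg k)
              (fun i hi => hmax i (Finset.mem_filter.1 hi).2) _) _
        _ ≤ _ := by
            have h2 := mul_le_mul_of_nonneg_left (not_le.1 hv).le (density_nonneg k)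
            rw [div_mul_cancel₀ _ (I.d_pos k).ne'] at h2
            linarith
    rcases h.last with hc | ⟨q, hqB, hqH, hqL, hqθ, hc⟩
    · refine ⟨H, e, I.p k, I.d k, h.subset, fun q hq => hL q (h.notMem q hq), h.inj, h.mem, h.le,
        fun q hq => (h.lt q hq).trans_le hθ,
        Or.inr ⟨k, hkB, hkH, by simp, le_rfl, rfl⟩, ?_⟩
      linarith [h.bound]
    · have hne : ∀ x ∈ H, x ≠ q := fun x hx hxq => hqH (hxq ▸ hx)
      have hup : ∀ x ∈ H, Function.update e q j x = e x := fun x hx =>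
        Function.update_of_ne (hne x hx) _ _
      refine ⟨insert q H, Function.update e q j, I.p k, I.d k, ?_, ?_, ?_, ?_, ?_, ?_,
        Or.inr ⟨k, hkB, ?_, by simp, le_rfl, rfl⟩, ?_⟩
      · exact Finset.insert_subset hqB h.subset
      · intro x hx
        rcases Finset.mem_insert.1 hx with rfl | hx
        · exact hL _ hqL
        · exact hL x (h.notMem x hx)
      · rw [Finset.coe_insert, Set.injOn_insert (by exact_mod_cast hqH)]
        refine ⟨?_, ?_⟩
        · intro x hx y hy hxy
          rw [hup x hx, hup y hy] at hxy
          exact h.inj hx hy hxy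
        · rintro ⟨x, hx, hxq⟩
          rw [hup x hx, Function.update_self] at hxq
          exact hej x hx hxq
      · intro x hx
        rcases Finset.mem_insert.1 hx with rfl | hx
        · simpa using hjK
        · rw [hup x hx]; exact h.mem x hx
      · intro x hx
        rcases Finset.mem_insert.1 hx with rfl | hx
        · simpa using hqθ.trans hθj
        · rw [hup x hx]; exact h.le x hx
      · intro x hx
        rcases Finset.mem_insert.1 hx with rfl | hx
        · simpa using hjk
        · rw [hup x hx]; exact (h.lt x hx).trans_le hθ
      · rw [Finset.mem_insert, not_or]
        exact ⟨fun hkq => hqL (hkq ▸ hk), hkH⟩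
      · rw [Finset.sum_insert hqH]
        linarith [h.bound]
  · refine ⟨H, e, c, θ, h.subset, fun q hq => hL q (h.notMem q hq), h.inj, h.mem, h.le, h.lt, ?_,
      ?_⟩
    · rcases h.last with hc | ⟨q, h1, h2, h3, h4⟩
      · exact Or.inl hc
      · exact Or.inr ⟨q, h1, h2, hL q h3, h4⟩
    · rw [← drop θ]
      · exact h.bound
      · exact fun hkB => share_eq_zero fun j hj hjU hθj =>
          hex ⟨hkB, j, hjU, hθj, hsmall k hkB j hj, k, hkB, hj⟩

theorem Run.exists_account [Nonempty (Fin I.n)] {L : Finset (Fin I.m)} {U : Finset (Fin I.n)}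
    {w : ℝ}
    (h : Run I (fun i => I.p i / I.d i) (SmallViable I) (SmallTake I) L U w)
    {B : Finset (Fin I.m)} {K : Fin I.m → Finset (Fin I.n)}
    (hK : ∀ i k, i ≠ k → Disjoint (K i) (K k)) (hsmall : ∀ i ∈ B, ∀ j ∈ K i, I.s j < I.d i)
    (hcov : ∀ i ∈ B, I.d i ≤ I.size (K i)) : ∃ H e c θ, Account I B K L U w H e c θ := by
  induction h with
  | start =>
    refine ⟨∅, fun _ => Classical.arbitrary _, 0, 0, by simp, by simp, by simp, by simp, by simp,
      by simp, Or.inl rfl, ?_⟩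
    have : ∀ i ∈ B, share I (K i) Finset.univ 0 i = I.p i := by
      intro i hi
      have hf : ({j ∈ K i ∩ Finset.univ | 0 ≤ I.s j} : Finset _) = K i := by
        ext j; simp [I.s_nonneg j]
      rw [share, hf, min_eq_left (hcov i hi), div_mul_cancel₀ _ (I.d_pos i).ne']
    simp [Finset.sum_congr rfl this]
  | take _ _ hmax hG ih =>
    obtain ⟨H, e, c, θ, ha⟩ := ih
    exact ⟨H, e, c, θ, ha.take hK hmax hG⟩
  | fail _ hk hmax hv ih =>
    obtain ⟨H, e, c, θ, ha⟩ := ih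
    exact ha.fail hK hsmall hk hmax hv

/-- The bound for bins that are covered by small items: up to the profit `c` of a single bin, and up
to a set `H` of bins that can be covered by one item each, their profit is at most `3 * w`. -/
theorem Run.small_le [Nonempty (Fin I.n)] {L : Finset (Fin I.m)} {U : Finset (Fin I.n)} {w : ℝ}
    (h : Run I (fun i => I.p i / I.d i) (SmallViable I) (SmallTake I) L U w)
    (hend : L = ∅ ∨ U = ∅) {B : Finset (Fin I.m)} {K : Fin I.m → Finset (Fin I.n)}
    (hK : ∀ i k, i ≠ k → Disjoint (K i) (K k)) (hsmall : ∀ i ∈ B, ∀ j ∈ K i, I.s j < I.d i)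
    (hcov : ∀ i ∈ B, I.d i ≤ I.size (K i)) :
    ∃ H ⊆ B, ∃ e, IsMatching I (B.biUnion K) H e ∧ ∃ c, (c = 0 ∨ ∃ q ∈ B, c = I.p q) ∧
      ∑ i ∈ B, I.p i ≤ 3 * w + ∑ q ∈ H, I.p q + c := by
  obtain ⟨H, e, c, θ, ha⟩ := h.exists_account hK hsmall hcov
  refine ⟨H, ha.subset, e, ⟨ha.inj, fun q hq => Finset.mem_biUnion.2 (ha.mem q hq), ha.le⟩, c, ?_,
    ?_⟩
  · rcases ha.last with hc | ⟨q, hq, _, _, _, hc⟩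
    · exact Or.inl hc
    · exact Or.inr ⟨q, hq, hc⟩
  · have h0 : ∑ i ∈ B with i ∈ L, share I (K i) U θ i = 0 := by
      refine Finset.sum_eq_zero fun i hi => ?_
      rcases hend with rfl | rfl
      · simp at hi
      · exact share_eq_zero fun j _ hj => by simp at hj
    linarith [ha.bound]

/-! ### The approximation ratio -/

/-- The bound for the optimum: the bins that a solution covers with the help of a large item, together
with the bins in `H`, form a matching, which is worth at most `w`; the remaining bins are worth at
most `3 * w'` and the profit of a single bin. -/
theorem Solution.profit_le [Nonempty (Fin I.n)] {L L' : Finset (Fin I.m)}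
    {U U' : Finset (Fin I.n)} {w w' v : ℝ}
    (h : Run I I.p (LargeViable I) (LargeTake I) L U w) (hend : L = ∅ ∨ U = ∅)
    (h' : Run I (fun i => I.p i / I.d i) (SmallViable I) (SmallTake I) L' U' w')
    (hend' : L' = ∅ ∨ U' = ∅) (hv0 : 0 ≤ v)
    (hv : ∀ i, I.d i ≤ I.size Finset.univ → I.p i ≤ v) (S : Solution I) :
    S.profit ≤ w + 3 * w' + v := by
  classical
  set C : Finset (Fin I.m) := {i | I.d i ≤ I.size (S.S i)} with hC
  have hprofit : S.profit = ∑ i ∈ C, I.p i := by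
    rw [Solution.profit, hC, Finset.sum_filter]
  set B₁ : Finset (Fin I.m) := {i ∈ C | ∃ j ∈ S.S i, I.d i ≤ I.s j} with hB₁
  set B₂ : Finset (Fin I.m) := {i ∈ C | ¬ ∃ j ∈ S.S i, I.d i ≤ I.s j} with hB₂
  have hsplit : ∑ i ∈ C, I.p i = ∑ i ∈ B₁, I.p i + ∑ i ∈ B₂, I.p i :=
    (Finset.sum_filter_add_sum_filter_not C _ _).symm
  obtain ⟨H, hH, e, he, c, hc, hle⟩ := h'.small_le hend' (B := B₂) (K := S.S) S.disjoint
    (fun i hi j hj => by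
      rw [hB₂, Finset.mem_filter] at hi
      by_contra hlt
      exact hi.2 ⟨j, hj, not_lt.1 hlt⟩)
    (fun i hi => by
      rw [hB₂, hC, Finset.mem_filter, Finset.mem_filter] at hi
      exact hi.1.2)
  have hcv : c ≤ v := by
    rcases hc with rfl | ⟨q, hq, rfl⟩
    · exact hv0
    · rw [hB₂, hC, Finset.mem_filter, Finset.mem_filter] at hq
      exact hv q (hq.1.2.trans (Instance.size_mono (Finset.subset_univ _)))
  have hex : ∀ i, ∃ j, i ∈ B₁ → j ∈ S.S i ∧ I.d i ≤ I.s j := by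
    intro i
    by_cases hi : i ∈ B₁
    · obtain ⟨j, hj⟩ := (Finset.mem_filter.1 hi).2
      exact ⟨j, fun _ => hj⟩
    · exact ⟨e i, fun hi' => absurd hi' hi⟩
  choose f hf using hex
  have hdisj : Disjoint B₁ B₂ := Finset.disjoint_filter_filter_not _ _ _
  have hdisjH : Disjoint B₁ H := hdisj.mono_right hH
  -- The large items of the solution and the items of `H` belong to different bins of the solution.
  have hne : ∀ i ∈ B₁, ∀ q ∈ H, f i ≠ e q := by
    intro i hi q hq heq
    obtain ⟨i', hi', hq'⟩ := Finset.mem_biUnion.1 (he.mem q hq)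
    have hii : i ≠ i' := fun hii => Finset.disjoint_left.1 hdisj hi (hii ▸ hi')
    exact Finset.disjoint_left.1 (S.disjoint i i' hii) (hf i hi).1 (heq ▸ hq')
  have hmatch : IsMatching I Finset.univ (B₁ ∪ H) (fun i => if i ∈ B₁ then f i else e i) := by
    have hHn : ∀ q ∈ H, q ∉ B₁ := fun q hq hq' => Finset.disjoint_left.1 hdisjH hq' hq
    refine ⟨?_, fun _ _ => Finset.mem_univ _, ?_⟩
    · intro x hx y hy hxy
      simp only [Finset.coe_union, Set.mem_union, Finset.mem_coe] at hx hy
      by_cases hx1 : x ∈ B₁ <;> by_cases hy1 : y ∈ B₁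
      · simp only [hx1, hy1, if_true] at hxy
        by_contra hxy'
        exact Finset.disjoint_left.1 (S.disjoint x y hxy') (hf x hx1).1 (hxy ▸ (hf y hy1).1)
      · simp only [hx1, hy1, if_true, if_false] at hxy
        exact absurd hxy (hne x hx1 y (hy.resolve_left hy1))
      · simp only [hx1, hy1, if_true, if_false] at hxy
        exact absurd hxy.symm (hne y hy1 x (hx.resolve_left hx1))
      · simp only [hx1, hy1, if_false] at hxy
        exact he.inj (hx.resolve_left hx1) (hy.resolve_left hy1) hxy
    · intro x hx
      by_cases hx1 : x ∈ B₁
      · simpa only [hx1, if_true] using (hf x hx1).2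
      · simpa only [hx1, if_false] using he.le x ((Finset.mem_union.1 hx).resolve_left hx1)
  have hM := h.matching_le hend hmatch
  rw [Finset.sum_union hdisjH] at hM
  linarith

theorem approxRatio_le {alg : (I : Instance) → Solution I} {a : ℝ} (ha : 0 ≤ a)
    (h : ∀ (I : Instance) (S : Solution I), S.profit ≤ a * (alg I).profit) :
    approxRatio alg ≤ ENNReal.ofReal a := by
  refine iSup_le fun I => ENNReal.div_le_of_le_mul (iSup_le fun S => ?_)
  rw [← ENNReal.ofReal_mul ha]
  exact ENNReal.ofReal_le_ofReal (h I S)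

/-! ### Selecting items for a bin -/


/-- The input is intact in the state `σ`. The program uses the memory as follows, where a scalar is
an array that is used at index `0` only.

Index arrays: `0` input; `1` best solution so far; `2` assignment of the current candidate, with `0`
for unused items and `i + 1` for items in the bin `i`; `3` marks of treated bins, with `0` for live
bins; `4` marks of the selected items. Scalars: `5`, `6`, `7` loop counters for bins, items and
rounds; `8` result of the search for the best live bin, as `i + 1`, or `0` if there is none; `9`
current bin; `10` success of the selection; `11` number of bins examined in advance in each round;
`12` number of rounds; `13`, `14` auxiliary.

Number arrays: `0`, `1`, `2` input. Scalars: `3` profit of the current candidate; `4` accumulated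
size; `5` profit of the best solution so far. -/
structure HasInput (I : Instance) (σ : State) : Prop where
  m : σ.idx 0 0 = I.m
  n : σ.idx 0 1 = I.n
  p : ∀ i : Fin I.m, σ.num 0 i = I.p i
  d : ∀ i : Fin I.m, σ.num 1 i = I.d i
  s : ∀ j : Fin I.n, σ.num 2 j = I.s j

theorem HasInput.congr {I : Instance} {σ τ : State} (h : HasInput I σ) (h0 : τ.idx 0 = σ.idx 0)
    (hn : ∀ a < 3, τ.num a = σ.num a) : HasInput I τ := by
  constructor
  · rw [h0, h.m]
  · rw [h0, h.n]
  · intro i; rw [hn 0 (by norm_num), h.p]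
  · intro i; rw [hn 1 (by norm_num), h.d]
  · intro i; rw [hn 2 (by norm_num), h.s]

theorem HasInput.frame {I : Instance} {P : Program} {σ τ : State} (h : HasInput I σ)
    (hF : Frame P σ τ) (h0 : 0 ∉ P.idxWrites) (hn : ∀ a < 3, a ∉ P.numWrites) : HasInput I τ :=
  h.congr (hF.1 0 h0) fun a ha => hF.2 a (hn a ha)

theorem hasInput_input (I : Instance) : HasInput I (input I) := by
  constructor <;> simp [input]

/-- The unused items, if `a` assigns to each item the number of its bin, counted from `1`. -/
def avail (I : Instance) (a : ℕ → ℕ) : Finset (Fin I.n) := {j | a j = 0}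

@[simp] theorem mem_avail {I : Instance} {a : ℕ → ℕ} {j : Fin I.n} : j ∈ avail I a ↔ a j = 0 := by
  simp [avail]

/-- The bins that are not marked in `D`. -/
def live (I : Instance) (D : ℕ → ℕ) : Finset (Fin I.m) := {i | D i = 0}

@[simp] theorem mem_live {I : Instance} {D : ℕ → ℕ} {i : Fin I.m} : i ∈ live I D ↔ D i = 0 := by
  simp [live]

/-- The solution in which the item `j` is put into the bin `i` if `a j = i + 1`. -/
def sol (I : Instance) (a : ℕ → ℕ) : Solution I where
  S i := {j | a j = i + 1}
  disjoint i k hik := by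
    rw [Finset.disjoint_left]
    intro j hj hj'
    simp only [Finset.mem_filter, Finset.mem_univ, true_and] at hj hj'
    exact hik (Fin.ext (by omega))

/-- The number of bins. -/
abbrev mE : IExpr := .read 0 (.const 0)

/-- The number of items. -/
abbrev nE : IExpr := .read 0 (.const 1)

/-- The demand of the current bin. -/
abbrev demandE : NExpr := .read 1 (ivar 9)

/-- The size of the item that is the counter of the loop over the items. -/
abbrev sizeE : NExpr := .read 2 (ivar 6)

theorem fin_lt_or_eq {n l : ℕ} (hl : l < n) {j : Fin n} (hj : (j : ℕ) < l + 1) :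
    (j : ℕ) < l ∨ j = ⟨l, hl⟩ := by
  rw [Fin.ext_iff]
  simp only
  omega

/-- One step of `tryLarge`: update the smallest unused item that covers the current bin alone. -/
def tryLargeStep : Program :=
  .seq (.setIdx 4 (ivar 6) (.const 0)) <|
  .ite (.idxLe (.read 2 (ivar 6)) (.const 0))
    (.ite (.numLe demandE sizeE)
      (.ite (.idxLe (ivar 13) (.const 0))
        (assign 13 (.add (ivar 6) (.const 1)))
        (.ite (.numLe (.read 2 (.sub (ivar 13) (.const 1))) sizeE) .skip
          (assign 13 (.add (ivar 6) (.const 1)))))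
      .skip)
    .skip

/-- Select a smallest unused item that covers the current bin alone. -/
def tryLarge : Program :=
  .seq (assign 13 (.const 0)) <|
  .seq (.for 6 nE tryLargeStep) <|
  .ite (.idxLe (ivar 13) (.const 0))
    (assign 10 (.const 0))
    (.seq (.setIdx 4 (.sub (ivar 13) (.const 1)) (.const 1)) (assign 10 (.const 1)))

/-- One step of `trySmall`: select an item, if it is unused and does not cover the current bin
alone, and if this bin is not yet covered. -/
def trySmallStep : Program :=
  .seq (.setIdx 4 (ivar 6) (.const 0)) <|
  .ite (.idxLe (.read 2 (ivar 6)) (.const 0))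
    (.ite (.numLe demandE sizeE) .skip
      (.ite (.numLe demandE (nvar 4)) .skip
        (.seq (.setIdx 4 (ivar 6) (.const 1)) (nassign 4 (.add (nvar 4) sizeE)))))
    .skip

/-- Select unused items that do not cover the current bin alone, until it is covered. -/
def trySmall : Program :=
  .seq (nassign 4 .zero) <|
  .seq (.for 6 nE trySmallStep) <|
  .ite (.numLe demandE (nvar 4)) (assign 10 (.const 1)) (assign 10 (.const 0))

/-- The program `P` selects a set of unused items as required by `Take` for the current bin, or
reports that the current bin is not viable. -/
structure IsTry (I : Instance) (Viable : Finset (Fin I.n) → Fin I.m → Prop)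
    (Take : Finset (Fin I.n) → Fin I.m → Finset (Fin I.n) → Prop) (P : Program) : Prop where
  idx : P.idxWrites ⊆ [4, 6, 10, 13]
  num : P.numWrites ⊆ [4]
  viable_mono : ∀ {U U' : Finset (Fin I.n)} {k}, U ⊆ U' → Viable U k → Viable U' k
  subset : ∀ {U : Finset (Fin I.n)} {k G}, Take U k G → G ⊆ U
  covers : ∀ {U : Finset (Fin I.n)} {k G}, Take U k G → I.d k ≤ I.size G
  viable : ∀ {U : Finset (Fin I.n)} {k G}, Take U k G → Viable U k
  reaches : ∀ {σ : State} {k : Fin I.m}, HasInput I σ → σ.idx 9 0 = k →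
    Reaches P σ (100 * I.n + 100) fun τ =>
      (τ.idx 10 0 = 1 ∧ Take (avail I (σ.idx 2)) k {j | τ.idx 4 j ≠ 0}) ∨
      (τ.idx 10 0 = 0 ∧ ¬ Viable (avail I (σ.idx 2)) k)

theorem isTry_tryLarge (I : Instance) : IsTry I (LargeViable I) (LargeTake I) tryLarge where
  idx := by decide
  num := by decide
  viable_mono h := fun ⟨j, hj, hj'⟩ => ⟨j, h hj, hj'⟩
  subset := by
    rintro U k _ ⟨j, hj, _, _, rfl⟩
    simpa using hj
  covers := by
    rintro U k _ ⟨j, _, hj, _, rfl⟩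
    simpa [Instance.size] using hj
  viable := fun ⟨j, hj, hj', _⟩ => ⟨j, hj, hj'⟩
  reaches {σ k} hI hk := by
    refine .cons (T' := I.n * 74 + 51) rfl (fun ρ hFρ hρ => ?_)
      (by simp only [Program.cost, IExpr.cost]; omega)
    have hIρ := hI.frame hFρ (by decide) (by decide)
    have h2ρ : ρ.idx 2 = σ.idx 2 := hFρ.1 2 (by decide)
    have h9ρ : ρ.idx 9 0 = k := by rw [hFρ.1 9 (by decide), hk]
    refine .bind (T₁ := I.n * 74 + 11) (T₂ := 40) (.for 60 (fun l τ =>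
      (∀ j < l, τ.idx 4 j = 0) ∧
      ((τ.idx 13 0 = 0 ∧ ∀ j ∈ avail I (σ.idx 2), j < l → ¬ I.d k ≤ I.s j) ∨
      ∃ b : Fin I.n, τ.idx 13 0 = b + 1 ∧ b ∈ avail I (σ.idx 2) ∧ I.d k ≤ I.s b ∧
        ∀ j ∈ avail I (σ.idx 2), j < l → I.d k ≤ I.s j → I.s b ≤ I.s j))
      (by decide) (N := I.n) ?_ ?_ ?_) ?_ (by omega)
    · intro τ hF
      simp [IExpr.eval, hF.1 0 (by decide), hIρ.n]
    · simp [hρ, Program.run, IExpr.eval]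
    · intro l τ hl hF hck hinv
      have hIτ := hIρ.frame hF (by decide) (by decide)
      have h2τ : τ.idx 2 = σ.idx 2 := by rw [hF.1 2 (by decide), h2ρ]
      have h9τ : τ.idx 9 0 = k := by rw [hF.1 9 (by decide), h9ρ]
      have hs := hIτ.s ⟨l, hl⟩
      have hd := hIτ.d k
      refine .run rfl (by decide) ?_
      simp only at hs
      simp only [tryLargeStep, Program.run, Test.Holds, IExpr.eval, NExpr.eval, hck, h2τ, h9τ, hs,
        hd, State.setIdx_num, State.setIdx_idx_of_ne _ _ _ (show 2 ≠ 4 by decide),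
        State.setIdx_idx_of_ne _ _ _ (show 6 ≠ 4 by decide),
        State.setIdx_idx_of_ne _ _ _ (show 9 ≠ 4 by decide),
        State.setIdx_idx_of_ne _ _ _ (show 13 ≠ 4 by decide), Nat.le_zero]
      obtain ⟨hT, hinv⟩ := hinv
      have hT' : ∀ j < l + 1, Function.update (τ.idx 4) l 0 j = 0 := fun j hj => by
        rcases eq_or_ne j l with rfl | hjl
        · simp
        · rw [Function.update_of_ne hjl]
          exact hT j (by omega)
      split_ifs with h1 h2 h3 h4
      · refine ⟨by simpa using hT', Or.inr ⟨⟨l, hl⟩, by simp, by simpa using h1, h2, ?_⟩⟩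
        intro j hj hjl hdj
        rcases fin_lt_or_eq hl hjl with hjl | rfl
        · rcases hinv with ⟨_, hinv⟩ | ⟨b, hb, _⟩
          · exact absurd hdj (hinv j hj hjl)
          · omega
        · exact le_rfl
      · rcases hinv with ⟨h0, _⟩ | ⟨b, hb, hb1, hb2, hinv⟩
        · exact absurd h0 h3
        rw [hb, Nat.add_sub_cancel, hIτ.s b] at h4
        refine ⟨by simpa using hT', Or.inr ⟨b, by simpa using hb, hb1, hb2, ?_⟩⟩
        intro j hj hjl hdj
        rcases fin_lt_or_eq hl hjl with hjl | rfl
        · exact hinv j hj hjl hdj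
        · exact h4
      · rcases hinv with ⟨h0, _⟩ | ⟨b, hb, hb1, hb2, hinv⟩
        · exact absurd h0 h3
        rw [hb, Nat.add_sub_cancel, hIτ.s b] at h4
        refine ⟨by simpa using hT', Or.inr ⟨⟨l, hl⟩, by simp, by simpa using h1, h2, ?_⟩⟩
        intro j hj hjl hdj
        rcases fin_lt_or_eq hl hjl with hjl | rfl
        · exact (not_le.1 h4).le.trans (hinv j hj hjl hdj)
        · exact le_rfl
      all_goals
        refine ⟨by simpa using hT', ?_⟩
        rcases hinv with ⟨h0, hinv⟩ | ⟨b, hb, hb1, hb2, hinv⟩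
        · refine Or.inl ⟨by simpa using h0, fun j hj hjl hdj => ?_⟩
          rcases fin_lt_or_eq hl hjl with hjl | rfl
          · exact hinv j hj hjl hdj
          · first | exact h2 hdj | exact h1 (by simpa using hj)
        · refine Or.inr ⟨b, by simpa using hb, hb1, hb2, fun j hj hjl hdj => ?_⟩
          rcases fin_lt_or_eq hl hjl with hjl | rfl
          · exact hinv j hj hjl hdj
          · first | exact absurd hdj h2 | exact absurd (by simpa using hj) h1
    · rintro τ - ⟨-, hT, hinv⟩
      refine .run rfl (by decide) ?_
      simp only [Program.run, Test.Holds, IExpr.eval, Nat.le_zero]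
      rcases hinv with ⟨h0, hinv⟩ | ⟨b, hb, hb1, hb2, hinv⟩
      · rw [if_pos h0]
        exact Or.inr ⟨by simp, fun ⟨j, hj, hdj⟩ => hinv j hj j.2 hdj⟩
      · rw [if_neg (by omega)]
        refine Or.inl ⟨by simp, b, hb1, hb2, fun j hj => hinv j hj j.2, ?_⟩
        ext j
        simp only [hb, Nat.add_sub_cancel, State.setIdx_idx_of_ne _ _ _ (show 4 ≠ 10 by decide),
          State.setIdx_idx_self, Function.update_apply, Finset.mem_filter, Finset.mem_univ,
          true_and, Finset.mem_singleton, Fin.ext_iff]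
        split_ifs with hjb <;> simp [hjb, hT j j.2]

theorem isTry_trySmall (I : Instance) : IsTry I (SmallViable I) (SmallTake I) trySmall where
  idx := by decide
  num := by decide
  viable_mono h hv := le_trans hv (Instance.size_mono (Finset.filter_subset_filter _ h))
  subset h := h.subset
  covers h := h.covers
  viable h := h.covers.trans
    (Instance.size_mono fun j hj => Finset.mem_filter.2 ⟨h.subset hj, h.lt j hj⟩)
  reaches {σ k} hI hk := by
    refine .cons (T' := I.n * 74 + 51) rfl (fun ρ hFρ hρ => ?_)
      (by simp only [Program.cost, IExpr.cost, NExpr.cost]; omega)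
    have hIρ := hI.frame hFρ (by decide) (by decide)
    have h2ρ : ρ.idx 2 = σ.idx 2 := hFρ.1 2 (by decide)
    have h9ρ : ρ.idx 9 0 = k := by rw [hFρ.1 9 (by decide), hk]
    -- As long as the bin is not covered, all suitable items have been selected.
    refine .bind (T₁ := I.n * 74 + 11) (T₂ := 40) (.for 60 (fun l τ =>
      (∀ j : Fin I.n, (j : ℕ) < l → τ.idx 4 j ≠ 0 → j ∈ avail I (σ.idx 2) ∧ I.s j < I.d k) ∧
      τ.num 4 0 = I.size {j | (j : ℕ) < l ∧ τ.idx 4 j ≠ 0} ∧ τ.num 4 0 ≤ 2 * I.d k ∧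
      (τ.num 4 0 < I.d k → ∀ j ∈ avail I (σ.idx 2), I.s j < I.d k → (j : ℕ) < l → τ.idx 4 j ≠ 0))
      (by decide) (N := I.n) ?_ ?_ ?_) ?_ (by omega)
    · intro τ hF
      simp [IExpr.eval, hF.1 0 (by decide), hIρ.n]
    · simp [hρ, Program.run, IExpr.eval, NExpr.eval, Instance.size, (I.d_pos k).le]
    · intro l τ hl hF hck hinv
      have hIτ := hIρ.frame hF (by decide) (by decide)
      have h2τ : τ.idx 2 = σ.idx 2 := by rw [hF.1 2 (by decide), h2ρ]
      have h9τ : τ.idx 9 0 = k := by rw [hF.1 9 (by decide), h9ρ]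
      have hs := hIτ.s ⟨l, hl⟩
      have hd := hIτ.d k
      obtain ⟨h1, h2, h3, h4⟩ := hinv
      refine .run rfl (by decide) ?_
      simp only at hs
      simp only [trySmallStep, Program.run, Test.Holds, IExpr.eval, NExpr.eval, hck, h2τ, h9τ, hs,
        hd, State.setIdx_num, State.setIdx_idx_of_ne _ _ _ (show 2 ≠ 4 by decide),
        State.setIdx_idx_of_ne _ _ _ (show 6 ≠ 4 by decide),
        State.setIdx_idx_of_ne _ _ _ (show 9 ≠ 4 by decide), Nat.le_zero]
      -- The invariant if the item `l` is not selected.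
      have hskip : (σ.idx 2 l = 0 → I.s ⟨l, hl⟩ < I.d k → ¬ τ.num 4 0 < I.d k) →
          (∀ j : Fin I.n, (j : ℕ) < l + 1 → Function.update (τ.idx 4) l 0 j ≠ 0 →
            j ∈ avail I (σ.idx 2) ∧ I.s j < I.d k) ∧
          τ.num 4 0 = I.size {j | (j : ℕ) < l + 1 ∧ Function.update (τ.idx 4) l 0 j ≠ 0} ∧
          τ.num 4 0 ≤ 2 * I.d k ∧ (τ.num 4 0 < I.d k → ∀ j ∈ avail I (σ.idx 2), I.s j < I.d k →
            (j : ℕ) < l + 1 → Function.update (τ.idx 4) l 0 j ≠ 0) := by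
        intro hno
        refine ⟨fun j hj hj' => ?_, ?_, h3, fun hlt j hj hjs hjl => ?_⟩
        · rcases eq_or_ne (j : ℕ) l with hjl | hjl
          · simp [hjl] at hj'
          · rw [Function.update_of_ne hjl] at hj'
            exact h1 j (by omega) hj'
        · rw [h2]
          congr 1
          ext j
          simp only [Finset.mem_filter, Finset.mem_univ, true_and, Function.update_apply]
          split_ifs with hjl
          · simp [hjl]
          · refine and_congr_left fun _ => ?_
            omega
        · rcases fin_lt_or_eq hl hjl with hjl | rfl
          · rw [Function.update_of_ne hjl.ne]
            exact h4 hlt j hj hjs hjl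
          · exact absurd hlt (hno (by simpa using hj) hjs)
      split_ifs with c1 c2 c3
      · simpa using hskip fun _ h => absurd c2 (not_le.2 h)
      · simpa using hskip fun _ _ => not_lt.2 c3
      · simp only [State.setNum_idx, State.setIdx_num, State.setIdx_idx_of_ne _ _ _
          (show 4 ≠ 6 by decide), State.setIdx_idx_self, State.setNum_num_self,
          Function.update_self, Function.update_idem]
        have hset : (Finset.univ.filter fun j : Fin I.n =>
              (j : ℕ) < l + 1 ∧ Function.update (τ.idx 4) l 1 j ≠ 0) =
            insert ⟨l, hl⟩ (Finset.univ.filter fun j : Fin I.n => (j : ℕ) < l ∧ τ.idx 4 j ≠ 0) := by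
          ext j
          simp only [Finset.mem_filter, Finset.mem_univ, true_and, Function.update_apply,
            Finset.mem_insert, Fin.ext_iff]
          split_ifs with hjl
          · simp [hjl]
          · simp only [hjl, false_or]
            refine and_congr_left fun _ => ?_
            omega
        push Not at c2 c3
        refine ⟨fun j hj hj' => ?_, ?_, by linarith, fun hlt j hj hjs hjl => ?_⟩
        · rcases fin_lt_or_eq hl hj with hjl | rfl
          · rw [Function.update_of_ne hjl.ne] at hj'
            exact h1 j hjl hj'
          · exact ⟨by simpa using c1, c2⟩
        · rw [hset, Instance.size, Finset.sum_insert (by simp), h2, add_comm]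
          rfl
        · rcases fin_lt_or_eq hl hjl with hjl | rfl
          · rw [Function.update_of_ne hjl.ne]
            exact h4 c3 j hj hjs hjl
          · simp
      · simpa using hskip fun h => absurd h c1
    · rintro τ hF ⟨-, h1, h2, h3, h4⟩
      have hIτ := hIρ.frame hF (by decide) (by decide)
      have h9τ : τ.idx 9 0 = k := by rw [hF.1 9 (by decide), h9ρ]
      have hset : (Finset.univ.filter fun j : Fin I.n => (j : ℕ) < I.n ∧ τ.idx 4 j ≠ 0) =
          Finset.univ.filter fun j : Fin I.n => τ.idx 4 j ≠ 0 := by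
        ext j; simp
      rw [hset] at h2
      refine .run rfl (by decide) ?_
      simp only [Program.run, Test.Holds, IExpr.eval, NExpr.eval, h9τ, hIτ.d k]
      split_ifs with hc
      · refine Or.inl ⟨by simp, ?_⟩
        simp only [State.setIdx_idx_of_ne _ _ _ (show 4 ≠ 10 by decide)]
        refine ⟨fun j hj => (h1 j j.2 (by simpa using hj)).1,
          fun j hj => (h1 j j.2 (by simpa using hj)).2, h2 ▸ hc, h2 ▸ h3⟩
      · refine Or.inr ⟨by simp, fun hv => hc (le_trans hv ?_)⟩
        rw [h2]
        refine Instance.size_mono fun j hj => ?_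
        rw [Finset.mem_filter] at hj
        simpa using h4 (not_le.1 hc) j hj.1 hj.2 j.2

/-! ### The greedy programs -/

/-- Give up bins that are not viable, among those whose number is less than the bound in the
variable `11`. If all bins are examined, then the bin found by `select` can be covered. -/
def prefilter (P : Program) : Program :=
  .for 5 (ivar 11) <|
    .ite (.idxLe (.read 3 (ivar 5)) (.const 0))
      (.seq (assign 9 (ivar 5)) <|
        .seq P <|
        .ite (.idxLe (ivar 10) (.const 0)) (.setIdx 3 (ivar 5) (.const 1)) .skip)
      .skip

/-- Find the last live bin that is best with respect to the test `b`, which compares the bins given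
by the variables `5` and `8`. -/
def select (b : Test) : Program :=
  .seq (assign 8 (.const 0)) <|
  .for 5 mE <|
    .ite (.idxLe (.read 3 (ivar 5)) (.const 0))
      (.ite (.idxLe (ivar 8) (.const 0))
        (assign 8 (.add (ivar 5) (.const 1)))
        (.ite b (assign 8 (.add (ivar 5) (.const 1))) .skip))
      .skip

/-- Cover the bin that was found by `select`, if this is possible. -/
def commit (P : Program) : Program :=
  .ite (.idxLe (ivar 8) (.const 0)) .skip <|
  .seq (assign 9 (.sub (ivar 8) (.const 1))) <|
  .seq P <|
  .seq (.setIdx 3 (ivar 9) (.const 1)) <|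
  .ite (.idxLe (ivar 10) (.const 0)) .skip <|
  .seq (nassign 3 (.add (nvar 3) (.read 0 (ivar 9)))) <|
  .for 6 nE <|
    .ite (.idxLe (.read 4 (ivar 6)) (.const 0)) .skip
      (.setIdx 2 (ivar 6) (.add (ivar 9) (.const 1)))

/-- One round of a greedy algorithm. -/
def round (b : Test) (P : Program) : Program :=
  .seq (prefilter P) (.seq (select b) (commit P))

/-- A greedy algorithm that treats the bins by the order `b` and selects items by `P`. The number of
rounds is given by the variable `12`. -/
def phase (b : Test) (P : Program) : Program :=
  .seq (.for 6 nE (.setIdx 2 (ivar 6) (.const 0))) <|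
  .seq (.for 5 mE (.setIdx 3 (ivar 5) (.const 0))) <|
  .seq (nassign 3 .zero) <|
  .for 7 (ivar 12) (round b P)

variable {κ : Fin I.m → ℝ} {Viable : Finset (Fin I.n) → Fin I.m → Prop}
  {Take : Finset (Fin I.n) → Fin I.m → Finset (Fin I.n) → Prop}

/-! ### The invariant of the greedy programs -/

theorem Solution.profit_nonneg (S : Solution I) : 0 ≤ S.profit :=
  Finset.sum_nonneg fun i _ => by split_ifs <;> simp [I.p_nonneg i]

open Classical in
theorem Solution.le_profit (S : Solution I) {k : Fin I.m} (hk : I.d k ≤ I.size (S.S k)) :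
    I.p k ≤ S.profit := by
  exact (if_pos hk).symm.le.trans (Finset.single_le_sum
    (f := fun i => if I.d i ≤ I.size (S.S i) then I.p i else 0)
    (fun i _ => by split_ifs <;> simp [I.p_nonneg i]) (Finset.mem_univ k))

theorem sol_congr {a a' : ℕ → ℕ} (h : ∀ j < I.n, a' j = a j) : sol I a' = sol I a := by
  have : ∀ j : Fin I.n, a' j = a j := fun j => h j j.2
  simp [sol, this]

theorem profit_sol_commit {a a' : ℕ → ℕ} {k : Fin I.m} {G : Finset (Fin I.n)}
    (hG : G ⊆ avail I a) (hcov : I.d k ≤ I.size G) (hk : ∀ j : Fin I.n, a j ≠ k + 1)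
    (ha' : ∀ j : Fin I.n, a' j = if j ∈ G then (k : ℕ) + 1 else a j) :
    (sol I a').profit = (sol I a).profit + I.p k := by
  classical
  have h0 : (sol I a).S k = ∅ := Finset.filter_eq_empty_iff.2 fun {j} _ => hk j
  have h1 : (sol I a').S k = G := by
    ext j
    simp only [sol, Finset.mem_filter, Finset.mem_univ, true_and, ha']
    split_ifs with hj <;> simp [hj, hk j]
  have h2 : ∀ i, i ≠ k → (sol I a').S i = (sol I a).S i := by
    intro i hi
    ext j
    simp only [sol, Finset.mem_filter, Finset.mem_univ, true_and, ha']
    split_ifs with hj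
    · have := hG hj
      rw [mem_avail] at this
      have hik : (i : ℕ) ≠ k := fun e => hi (Fin.ext e)
      constructor <;> intro <;> omega
    · rfl
  have h3 : ∀ i : Fin I.m, (if I.d i ≤ I.size ((sol I a').S i) then I.p i else 0) =
      (if I.d i ≤ I.size ((sol I a).S i) then I.p i else 0) + if i = k then I.p k else 0 := by
    intro i
    rcases eq_or_ne i k with rfl | hik
    · rw [h0, h1, if_pos hcov, if_pos rfl,
        if_neg (show ¬ I.d i ≤ I.size ∅ from not_le.2 (I.d_pos i)), zero_add]
    · simp [h2 i hik, hik]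
  simp only [Solution.profit, h3, Finset.sum_add_distrib]
  simp

/-- The state of a greedy program: `a` is the assignment of items, `D` marks the bins that are
treated, and `w` is the profit. Bins that are not viable may have been marked ahead of their turn;
then the corresponding run still has to treat them. -/
structure PhaseInv (I : Instance) (κ : Fin I.m → ℝ) (Viable : Finset (Fin I.n) → Fin I.m → Prop)
    (Take : Finset (Fin I.n) → Fin I.m → Finset (Fin I.n) → Prop) (a D : ℕ → ℕ) (w : ℝ) :
    Prop where
  run : ∃ L, Run I κ Viable Take L (avail I a) w ∧ live I D ⊆ L ∧
    ∀ q ∈ L, q ∉ live I D → ¬ Viable (avail I a) q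
  profit : (sol I a).profit = w
  marked : ∀ (j : Fin I.n) (i : Fin I.m), a j = i + 1 → i ∉ live I D

theorem PhaseInv.start {a D : ℕ → ℕ} (ha : ∀ j < I.n, a j = 0) (hD : ∀ i < I.m, D i = 0) :
    PhaseInv I κ Viable Take a D 0 where
  run := by
    have h1 : avail I a = Finset.univ := by ext j; simp [ha j j.2]
    have h2 : live I D = Finset.univ := by ext i; simp [hD i i.2]
    exact ⟨Finset.univ, h1 ▸ .start, by simp, by simp [h2]⟩
  profit := by
    refine Finset.sum_eq_zero fun i _ => if_neg (not_le.2 ?_)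
    have : (sol I a).S i = ∅ := Finset.filter_eq_empty_iff.2 fun {j} _ => by simp [ha j j.2]
    rw [this]
    exact I.d_pos i
  marked j i h := by simp [ha j j.2] at h

theorem live_update {D : ℕ → ℕ} (k : Fin I.m) :
    live I (Function.update D k 1) = (live I D).erase k := by
  ext i
  rw [mem_live, Finset.mem_erase, mem_live, Function.update_apply, ne_eq, Fin.ext_iff]
  split_ifs with h <;> simp [h]

theorem PhaseInv.giveUp {a D : ℕ → ℕ} {w : ℝ} (h : PhaseInv I κ Viable Take a D w) {k : Fin I.m}
    (hk : ¬ Viable (avail I a) k) : PhaseInv I κ Viable Take a (Function.update D k 1) w where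
  run := by
    obtain ⟨L, h1, h2, h3⟩ := h.run
    rw [live_update]
    refine ⟨L, h1, (Finset.erase_subset _ _).trans h2, fun q hq hqD => ?_⟩
    rcases eq_or_ne q k with rfl | hqk
    · exact hk
    · exact h3 q hq fun hqL => hqD (Finset.mem_erase.2 ⟨hqk, hqL⟩)
  profit := h.profit
  marked j i hji hi := h.marked j i hji (by rw [live_update] at hi; exact Finset.mem_of_mem_erase hi)

theorem avail_commit {a a' : ℕ → ℕ} {k : Fin I.m} {G : Finset (Fin I.n)}
    (ha' : ∀ j : Fin I.n, a' j = if j ∈ G then (k : ℕ) + 1 else a j) :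
    avail I a' = avail I a \ G := by
  ext j
  simp only [mem_avail, ha', Finset.mem_sdiff]
  split_ifs with hj <;> simp [hj]

theorem PhaseInv.commit {P : Program} (hP : IsTry I Viable Take P) {a a' D : ℕ → ℕ} {w : ℝ}
    (h : PhaseInv I κ Viable Take a D w) {k : Fin I.m} (hk : k ∈ live I D)
    (hmax : ∀ i ∈ live I D, κ i ≤ κ k) {G : Finset (Fin I.n)} (hG : Take (avail I a) k G)
    (ha' : ∀ j : Fin I.n, a' j = if j ∈ G then (k : ℕ) + 1 else a j) :
    PhaseInv I κ Viable Take a' (Function.update D k 1) (w + I.p k) where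
  run := by
    obtain ⟨L, h1, h2, h3⟩ := h.run
    obtain ⟨L', h4, h5, h6, h7⟩ := h1.discard (κ k) (fun i hi => WithBot.coe_le_coe.2 (hmax i hi))
      h2 h3
    rw [live_update, avail_commit ha']
    refine ⟨L'.erase k, h6.take (h5 hk) (fun i hi => WithBot.coe_le_coe.1 (h7 i hi)) hG,
      Finset.erase_subset_erase _ h5, fun q hq hqD hv => ?_⟩
    rw [Finset.mem_erase] at hq
    exact h3 q (h4 hq.2) (fun hqL => hqD (Finset.mem_erase.2 ⟨hq.1, hqL⟩))
      (hP.viable_mono Finset.sdiff_subset hv)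
  profit := by
    rw [profit_sol_commit (hP.subset hG) (hP.covers hG) (fun j hj => h.marked j k hj hk) ha',
      h.profit]
  marked j i hji := by
    rw [live_update, Finset.mem_erase, not_and]
    intro hik
    refine h.marked j i ?_
    rw [ha'] at hji
    split_ifs at hji with hj
    · exact absurd (Fin.ext (by omega)) hik
    · exact hji

theorem PhaseInv.finish {a D : ℕ → ℕ} {w : ℝ} (h : PhaseInv I κ Viable Take a D w)
    (hend : live I D = ∅ ∨ avail I a = ∅) :
    ∃ L U, Run I κ Viable Take L U w ∧ (L = ∅ ∨ U = ∅) := by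
  obtain ⟨L, h1, h2, h3⟩ := h.run
  rcases hend with hD | ha
  · obtain ⟨L', -, -, h4, h5⟩ := h1.discard ⊥ (by simp [hD]) h2 h3
    exact ⟨L', _, h4, Or.inl (Finset.eq_empty_of_forall_notMem fun i hi => by simpa using h5 i hi)⟩
  · exact ⟨L, _, h1, Or.inr ha⟩

/-! ### The parts of the greedy programs -/

/-- The test `b` compares the keys of the bins given by the variables `5` and `8`. -/
structure IsOrder (I : Instance) (κ : Fin I.m → ℝ) (b : Test) : Prop where
  cost : b.cost ≤ 30
  holds_iff : ∀ {σ : State} {i k : Fin I.m}, HasInput I σ → σ.idx 5 0 = i → σ.idx 8 0 = k + 1 →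
    (b.Holds σ ↔ κ k ≤ κ i)

theorem IsTry.idx_notMem {P : Program} (hP : IsTry I Viable Take P) {a : ℕ}
    (ha : a ∉ [4, 6, 10, 13]) : a ∉ P.idxWrites := fun h => ha (hP.idx h)

theorem IsTry.num_notMem {P : Program} (hP : IsTry I Viable Take P) {a : ℕ}
    (ha : a ≠ 4) : a ∉ P.numWrites := fun h => ha (by simpa using hP.num h)

theorem IsTry.prefilter_idx {P : Program} (hP : IsTry I Viable Take P) {a : ℕ}
    (ha : a ∉ [3, 4, 5, 6, 9, 10, 13]) : a ∉ (prefilter P).idxWrites := by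
  have := hP.idx_notMem (a := a)
  simp [prefilter, Program.for, Program.idxWrites] at ha this ⊢
  tauto

theorem IsTry.prefilter_num {P : Program} (hP : IsTry I Viable Take P) {a : ℕ}
    (ha : a ≠ 4) : a ∉ (prefilter P).numWrites := by
  simpa [prefilter, Program.for, Program.numWrites] using hP.num_notMem ha

theorem IsTry.commit_idx {P : Program} (hP : IsTry I Viable Take P) {a : ℕ}
    (ha : a ∉ [2, 3, 4, 6, 9, 10, 13]) : a ∉ (commit P).idxWrites := by
  have := hP.idx_notMem (a := a)
  simp [commit, Program.for, Program.idxWrites] at ha this ⊢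
  tauto

theorem IsTry.commit_num {P : Program} (hP : IsTry I Viable Take P) {a : ℕ}
    (ha : a ∉ [3, 4]) : a ∉ (commit P).numWrites := by
  have := hP.num_notMem (a := a)
  simp [commit, Program.for, Program.numWrites] at ha this ⊢
  tauto

theorem reaches_prefilter {P : Program} (hP : IsTry I Viable Take P) {σ : State}
    (hI : HasInput I σ) (h : PhaseInv I κ Viable Take (σ.idx 2) (σ.idx 3) (σ.num 3 0)) {F : ℕ}
    (hF : σ.idx 11 0 = F) (hFm : F ≤ I.m) :
    Reaches (prefilter P) σ (F * (100 * I.n + 150) + 20) fun τ =>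
      PhaseInv I κ Viable Take (σ.idx 2) (τ.idx 3) (σ.num 3 0) ∧
      live I (τ.idx 3) ⊆ live I (σ.idx 3) ∧
      ∀ i ∈ live I (τ.idx 3), (i : ℕ) < F → Viable (avail I (σ.idx 2)) i := by
  refine (Reaches.for (100 * I.n + 130) (fun l τ =>
    PhaseInv I κ Viable Take (σ.idx 2) (τ.idx 3) (σ.num 3 0) ∧
      live I (τ.idx 3) ⊆ live I (σ.idx 3) ∧
      ∀ i ∈ live I (τ.idx 3), (i : ℕ) < l → Viable (avail I (σ.idx 2)) i)
    ?_ (N := F) ?_ ?_ ?_).mono (by simp only [IExpr.cost]; ring_nf; omega) fun τ hτ => hτ.2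
  · have := hP.idx_notMem (a := 5)
    simp [Program.idxWrites] at this ⊢
    tauto
  · intro τ hFr
    change Frame (prefilter P) σ τ at hFr
    simp [IExpr.eval, hFr.1 11 (hP.prefilter_idx (by decide)), hF]
  · simpa using h
  · intro l τ hl hFr hck ⟨h1, h2, h3⟩
    change Frame (prefilter P) σ τ at hFr
    have hIτ := hI.frame hFr (hP.prefilter_idx (by decide))
      fun a ha => hP.prefilter_num (by omega)
    have h2τ : τ.idx 2 = σ.idx 2 := hFr.1 2 (hP.prefilter_idx (by decide))
    have hlm : l < I.m := hl.trans_le hFm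
    refine .ite (T := 100 * I.n + 120) (fun hlive => ?_) (fun hlive => ?_)
      (by simp only [Test.cost, IExpr.cost]; omega)
    · refine .cons (T' := 100 * I.n + 115) rfl (fun ρ hFρ hρ => ?_)
        (by simp only [Program.cost, IExpr.cost]; omega)
      have hIρ := hIτ.frame hFρ (by decide) (by decide)
      have h9ρ : ρ.idx 9 0 = (⟨l, hlm⟩ : Fin I.m) := by simp [hρ, Program.run, IExpr.eval, hck]
      refine .bind (T₂ := 12) (hP.reaches hIρ h9ρ) (fun υ hFυ hυ => ?_) (by omega)
      have h3υ : υ.idx 3 = τ.idx 3 := by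
        rw [hFυ.1 3 (hP.idx_notMem (by decide)), hFρ.1 3 (by decide)]
      have h5υ : υ.idx 5 0 = l := by
        rw [hFυ.1 5 (hP.idx_notMem (by decide)), hFρ.1 5 (by decide), hck]
      rw [hFρ.1 2 (by decide), h2τ] at hυ
      refine .run rfl (by decide) ?_
      rcases hυ with ⟨hok, hυ⟩ | ⟨hok, hυ⟩
      · have hc : ¬ (Test.idxLe (ivar 10) (.const 0)).Holds υ := by
          simp [Test.Holds, IExpr.eval, hok]
        simp only [Program.run, if_neg hc, State.setIdx_idx_of_ne _ _ _ (show 3 ≠ 5 by decide),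
          h3υ]
        refine ⟨h1, h2, fun i hi hil => ?_⟩
        rcases fin_lt_or_eq hlm hil with hil | rfl
        · exact h3 i hi hil
        · exact hP.viable hυ
      · have hc : (Test.idxLe (ivar 10) (.const 0)).Holds υ := by
          simp [Test.Holds, IExpr.eval, hok]
        simp only [Program.run, if_pos hc, IExpr.eval, State.setIdx_idx_of_ne _ _ _
          (show 3 ≠ 5 by decide), State.setIdx_idx_self, h3υ, h5υ]
        have hup := live_update (D := τ.idx 3) (⟨l, hlm⟩ : Fin I.m)
        simp only at hup
        refine ⟨h1.giveUp hυ, ?_, fun i hi hil => ?_⟩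
        · rw [hup]
          exact (Finset.erase_subset _ _).trans h2
        · rw [hup, Finset.mem_erase] at hi
          exact h3 i hi.2 ((fin_lt_or_eq hlm hil).resolve_right hi.1)
    · refine .run rfl (by simp only [Program.cost]; omega) ?_
      simp only [Program.run, State.setIdx_idx_of_ne _ _ _ (show 3 ≠ 5 by decide)]
      refine ⟨h1, h2, fun i hi hil => ?_⟩
      rcases fin_lt_or_eq hlm hil with hil | rfl
      · exact h3 i hi hil
      · simp only [Test.Holds, IExpr.eval, hck, Nat.le_zero] at hlive
        exact absurd (by simpa using hi) hlive

theorem reaches_select {b : Test} (hb : IsOrder I κ b) {σ : State} (hI : HasInput I σ) :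
    Reaches (select b) σ (I.m * 100 + 20) fun τ =>
      (τ.idx 8 0 = 0 ∧ live I (σ.idx 3) = ∅) ∨
      ∃ k ∈ live I (σ.idx 3), τ.idx 8 0 = k + 1 ∧ ∀ i ∈ live I (σ.idx 3), κ i ≤ κ k := by
  have hcost := hb.cost
  refine .cons (T' := I.m * 100 + 11) rfl (fun ρ hFρ hρ => ?_)
    (by simp only [Program.cost, IExpr.cost]; omega)
  have hIρ := hI.frame hFρ (by decide) (by decide)
  have h3ρ : ρ.idx 3 = σ.idx 3 := hFρ.1 3 (by decide)
  refine (Reaches.for 80 (fun l τ =>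
      (τ.idx 8 0 = 0 ∧ ∀ i ∈ live I (σ.idx 3), ¬ (i : ℕ) < l) ∨
      ∃ k ∈ live I (σ.idx 3), τ.idx 8 0 = k + 1 ∧
        ∀ i ∈ live I (σ.idx 3), (i : ℕ) < l → κ i ≤ κ k)
    (by simp [Program.idxWrites]) (N := I.m) ?_ ?_ ?_).mono
    (by simp only [IExpr.cost]; ring_nf; omega) ?_
  · intro τ hF
    simp [IExpr.eval, hF.1 0 (by simp [Program.for, Program.idxWrites]), hIρ.m]
  · simp [hρ, Program.run, IExpr.eval]
  · intro l τ hl hF hck hinv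
    have hIτ := hIρ.frame hF (by simp [Program.for, Program.idxWrites])
      (by simp [Program.for, Program.numWrites])
    have h3τ : τ.idx 3 = σ.idx 3 := by
      rw [hF.1 3 (by simp [Program.for, Program.idxWrites]), h3ρ]
    refine .run rfl (by simp only [Program.cost, Test.cost_idxLe, IExpr.cost]; omega) ?_
    simp only [Program.run, Test.holds_idxLe, IExpr.eval, hck, h3τ, Nat.le_zero]
    have hlive : (⟨l, hl⟩ : Fin I.m) ∈ live I (σ.idx 3) ↔ σ.idx 3 l = 0 := mem_live
    split_ifs with c1 c2 c3
    · refine Or.inr ⟨⟨l, hl⟩, hlive.2 c1, by simp, fun i hi hil => ?_⟩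
      rcases fin_lt_or_eq hl hil with hil | rfl
      · rcases hinv with ⟨_, hinv⟩ | ⟨k, _, hk, _⟩
        · exact absurd hil (hinv i hi)
        · omega
      · exact le_rfl
    · rcases hinv with ⟨h0, _⟩ | ⟨k, hkl, hk, hinv⟩
      · exact absurd h0 c2
      have hle := (hb.holds_iff (i := ⟨l, hl⟩) hIτ hck hk).1 c3
      refine Or.inr ⟨⟨l, hl⟩, hlive.2 c1, by simp, fun i hi hil => ?_⟩
      rcases fin_lt_or_eq hl hil with hil | rfl
      · exact (hinv i hi hil).trans hle
      · exact le_rfl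
    · rcases hinv with ⟨h0, _⟩ | ⟨k, hkl, hk, hinv⟩
      · exact absurd h0 c2
      have hle := mt (hb.holds_iff (i := ⟨l, hl⟩) hIτ hck hk).2 c3
      refine Or.inr ⟨k, hkl, by simpa using hk, fun i hi hil => ?_⟩
      rcases fin_lt_or_eq hl hil with hil | rfl
      · exact hinv i hi hil
      · exact (not_le.1 hle).le
    · rcases hinv with ⟨h0, hinv⟩ | ⟨k, hkl, hk, hinv⟩
      · refine Or.inl ⟨by simpa using h0, fun i hi hil => ?_⟩
        rcases fin_lt_or_eq hl hil with hil | rfl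
        · exact hinv i hi hil
        · exact c1 (hlive.1 hi)
      · refine Or.inr ⟨k, hkl, by simpa using hk, fun i hi hil => ?_⟩
        rcases fin_lt_or_eq hl hil with hil | rfl
        · exact hinv i hi hil
        · exact absurd (hlive.1 hi) c1
  · rintro τ ⟨-, ⟨h0, h⟩ | ⟨k, hk, hk', h⟩⟩
    · exact Or.inl ⟨h0, Finset.eq_empty_of_forall_notMem fun i hi => h i hi i.2⟩
    · exact Or.inr ⟨k, hk, hk', fun i hi => h i hi i.2⟩

theorem reaches_commit {P : Program} (hP : IsTry I Viable Take P) {σ : State}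
    (hI : HasInput I σ) (h : PhaseInv I κ Viable Take (σ.idx 2) (σ.idx 3) (σ.num 3 0))
    {k : Fin I.m} (hk : k ∈ live I (σ.idx 3)) (hmax : ∀ i ∈ live I (σ.idx 3), κ i ≤ κ k)
    (hbest : σ.idx 8 0 = k + 1) :
    Reaches (commit P) σ (140 * I.n + 200) fun τ =>
      PhaseInv I κ Viable Take (τ.idx 2) (τ.idx 3) (τ.num 3 0) ∧
      live I (τ.idx 3) = (live I (σ.idx 3)).erase k ∧
      avail I (τ.idx 2) ⊆ avail I (σ.idx 2) ∧
      (Viable (avail I (σ.idx 2)) k → avail I (τ.idx 2) ⊂ avail I (σ.idx 2)) := by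
  refine .ite (T := 140 * I.n + 190) (fun h0 => ?_) (fun _ => ?_)
    (by simp only [Test.cost, IExpr.cost]; omega)
  · simp only [Test.Holds, IExpr.eval, hbest] at h0
    omega
  refine .cons (T' := 140 * I.n + 180) rfl (fun ρ hFρ hρ => ?_)
    (by simp only [Program.cost, IExpr.cost]; omega)
  have hIρ := hI.frame hFρ (by decide) (by decide)
  have h9ρ : ρ.idx 9 0 = k := by simp [hρ, Program.run, IExpr.eval, hbest]
  refine .bind (T₂ := 40 * I.n + 80) (hP.reaches hIρ h9ρ) (fun υ hFυ hυ => ?_) (by omega)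
  have hIυ := hIρ.frame hFυ (hP.idx_notMem (by decide)) fun a ha => hP.num_notMem (by omega)
  have h2υ : υ.idx 2 = σ.idx 2 := by
    rw [hFυ.1 2 (hP.idx_notMem (by decide)), hFρ.1 2 (by decide)]
  have h3υ : υ.idx 3 = σ.idx 3 := by
    rw [hFυ.1 3 (hP.idx_notMem (by decide)), hFρ.1 3 (by decide)]
  have h9υ : υ.idx 9 0 = k := by rw [hFυ.1 9 (hP.idx_notMem (by decide)), h9ρ]
  have hWυ : υ.num 3 = σ.num 3 := by
    rw [hFυ.2 3 (hP.num_notMem (by decide)), hFρ.2 3 (by decide)]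
  rw [hFρ.1 2 (by decide)] at hυ
  refine .cons (T' := 40 * I.n + 70) rfl (fun φ hFφ hφ => ?_)
    (by simp only [Program.cost, IExpr.cost]; omega)
  have hIφ := hIυ.frame hFφ (by decide) (by decide)
  have h2φ : φ.idx 2 = σ.idx 2 := by rw [hFφ.1 2 (by decide), h2υ]
  have h3φ : φ.idx 3 = Function.update (σ.idx 3) k 1 := by
    simp [hφ, Program.run, IExpr.eval, h3υ, h9υ]
  have h9φ : φ.idx 9 0 = k := by rw [hFφ.1 9 (by decide), h9υ]
  have hWφ : φ.num 3 = σ.num 3 := by rw [hFφ.2 3 (by decide), hWυ]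
  rw [← hFφ.1 10 (by decide), ← hFφ.1 4 (by decide)] at hυ
  refine .ite (T := 40 * I.n + 60) (fun hok => ?_) (fun hok => ?_)
    (by simp only [Test.cost, IExpr.cost]; omega)
  · simp only [Test.Holds, IExpr.eval, Nat.le_zero] at hok
    obtain ⟨_, hv⟩ := hυ.resolve_left (by omega)
    refine .run rfl (by simp only [Program.cost]; omega) ?_
    simp only [Program.run, h2φ, h3φ, hWφ]
    exact ⟨h.giveUp hv, live_update k, subset_rfl, fun hv' => absurd hv' hv⟩
  · simp only [Test.Holds, IExpr.eval, Nat.le_zero] at hok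
    obtain ⟨_, hG⟩ := hυ.resolve_right (by omega)
    refine .cons (T' := 40 * I.n + 20) rfl (fun ψ hFψ hψ => ?_)
      (by simp only [Program.cost, IExpr.cost, NExpr.cost]; omega)
    have hIψ := hIφ.congr (hFψ.1 0 (by decide)) fun a ha => hFψ.2 a
      (by simp [Program.numWrites]; omega)
    have h9ψ : ψ.idx 9 0 = k := by rw [hFψ.1 9 (by decide), h9φ]
    have hWψ : ψ.num 3 0 = σ.num 3 0 + I.p k := by
      simp [hψ, Program.run, IExpr.eval, NExpr.eval, hWφ, h9φ, hIφ.p]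
    refine (Reaches.for 20 (fun l τ => ∀ j, τ.idx 2 j =
        if j < l ∧ φ.idx 4 j ≠ 0 then (k : ℕ) + 1 else σ.idx 2 j)
      (by decide) (N := I.n) ?_ ?_ ?_).mono
      (by simp only [IExpr.cost]; ring_nf; omega) ?_
    · intro τ hF
      simp [IExpr.eval, hF.1 0 (by decide), hIψ.n]
    · simp [hFψ.1 2 (by decide), h2φ]
    · intro l τ hl hF hck hinv
      have h4τ : τ.idx 4 = φ.idx 4 := by rw [hF.1 4 (by decide), hFψ.1 4 (by decide)]
      have h9τ : τ.idx 9 0 = k := by rw [hF.1 9 (by decide), h9ψ]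
      refine .run rfl (by decide) fun j => ?_
      simp only [Program.run, Test.Holds, IExpr.eval, hck, h4τ, h9τ, Nat.le_zero]
      rcases eq_or_ne j l with rfl | hjl
      · split_ifs with c1 c2 c3 <;> simp_all
      · have : j < l + 1 ↔ j < l := by omega
        split_ifs with c1 c2 c3 <;> simp_all
    · rintro τ ⟨hF, hinv⟩
      have hinv' : ∀ j : Fin I.n, τ.idx 2 j =
          if j ∈ (Finset.univ.filter fun j : Fin I.n => φ.idx 4 j ≠ 0) then (k : ℕ) + 1
          else σ.idx 2 j := fun j => by
        rw [hinv]
        simp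
      have h3τ : τ.idx 3 = Function.update (σ.idx 3) k 1 := by
        rw [hF.1 3 (by decide), hFψ.1 3 (by decide), h3φ]
      have hWτ : τ.num 3 0 = σ.num 3 0 + I.p k := by rw [hF.2 3 (by decide), hWψ]
      rw [h3τ, hWτ, avail_commit hinv']
      refine ⟨h.commit hP hk hmax hG hinv', live_update k, Finset.sdiff_subset, fun _ => ?_⟩
      refine Finset.sdiff_ssubset (hP.subset hG) ?_
      rw [Finset.nonempty_iff_ne_empty]
      intro h0
      have := hP.covers hG
      rw [h0] at this
      exact absurd this (not_le.2 (I.d_pos k))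

/-- In each round a live bin is treated, and an item is used up if all bins are examined in
advance, unless no live bin is left. -/
theorem reaches_round {b : Test} (hb : IsOrder I κ b) {P : Program} (hP : IsTry I Viable Take P)
    {σ : State} (hI : HasInput I σ)
    (h : PhaseInv I κ Viable Take (σ.idx 2) (σ.idx 3) (σ.num 3 0)) {F : ℕ}
    (hF : σ.idx 11 0 = F) (hFm : F ≤ I.m) :
    Reaches (round b P) σ (F * (100 * I.n + 150) + I.m * 100 + 140 * I.n + 250) fun τ =>
      PhaseInv I κ Viable Take (τ.idx 2) (τ.idx 3) (τ.num 3 0) ∧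
      (live I (τ.idx 3) = ∅ ∨ ((live I (τ.idx 3)).card < (live I (σ.idx 3)).card ∧
        (F = I.m → (avail I (τ.idx 2)).card < (avail I (σ.idx 2)).card))) := by
  refine .bind (T₂ := I.m * 100 + 140 * I.n + 230) (reaches_prefilter hP hI h hF hFm)
    (fun ρ hFρ hρ => ?_) (by omega)
  obtain ⟨hρ1, hρ2, hρ3⟩ := hρ
  have hIρ := hI.frame hFρ (hP.prefilter_idx (by decide)) fun a ha => hP.prefilter_num (by omega)
  rw [← hFρ.1 2 (hP.prefilter_idx (by decide)), ← hFρ.2 3 (hP.prefilter_num (by decide))] at hρ1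
  rw [← hFρ.1 2 (hP.prefilter_idx (by decide))] at hρ3 ⊢
  refine .bind (T₂ := 140 * I.n + 200) (reaches_select hb hIρ) (fun υ hFυ hυ => ?_) (by omega)
  have hsel : ∀ a, a ∉ [5, 8] → a ∉ (select b).idxWrites := by
    intro a ha
    simp [select, Program.for, Program.idxWrites] at ha ⊢
    omega
  have hselN : ∀ a, a ∉ (select b).numWrites := by
    simp [select, Program.for, Program.numWrites]
  have hIυ := hIρ.frame hFυ (hsel 0 (by decide)) fun a _ => hselN a
  have h2υ : υ.idx 2 = ρ.idx 2 := hFυ.1 2 (hsel 2 (by decide))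
  have h3υ : υ.idx 3 = ρ.idx 3 := hFυ.1 3 (hsel 3 (by decide))
  have hWυ : υ.num 3 = ρ.num 3 := hFυ.2 3 (hselN 3)
  rcases hυ with ⟨h0, hlive⟩ | ⟨k, hk, hbest, hmax⟩
  · refine .ite (T := 1) (fun _ => .run rfl le_rfl ?_) (fun hne => absurd ?_ hne)
      (by simp only [Test.cost, IExpr.cost]; omega)
    · simp only [Program.run, h2υ, h3υ, hWυ]
      exact ⟨hρ1, Or.inl hlive⟩
    · simp [Test.Holds, IExpr.eval, h0]
  · rw [← h3υ] at hk hmax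
    refine (reaches_commit hP hIυ (by rwa [h2υ, h3υ, hWυ]) hk hmax hbest).mono le_rfl ?_
    rintro τ ⟨h1, h2, h3, h4⟩
    refine ⟨h1, Or.inr ⟨?_, fun hFm => ?_⟩⟩
    · rw [h2]
      refine (Finset.card_erase_lt_of_mem hk).trans_le (Finset.card_le_card ?_)
      rwa [h3υ]
    · rw [h2υ] at h4
      exact Finset.card_lt_card (h4 (hρ3 k (h3υ ▸ hk) (hFm ▸ k.2)))

theorem rounds_idx {b : Test} {P : Program} (hP : IsTry I Viable Take P) {a : ℕ}
    (ha : a ∉ [2, 3, 4, 5, 6, 7, 8, 9, 10, 13]) :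
    a ∉ (Program.for 7 (ivar 12) (round b P)).idxWrites := by
  have h1 := hP.prefilter_idx (a := a)
  have h2 := hP.commit_idx (a := a)
  simp [round, select, Program.for, Program.idxWrites] at ha h1 h2 ⊢
  tauto

theorem rounds_num {b : Test} {P : Program} (hP : IsTry I Viable Take P) {a : ℕ}
    (ha : a ∉ [3, 4]) : a ∉ (Program.for 7 (ivar 12) (round b P)).numWrites := by
  have h1 := hP.prefilter_num (a := a)
  have h2 := hP.commit_num (a := a)
  simp [round, select, Program.for, Program.numWrites] at ha h1 h2 ⊢
  tauto

theorem phase_idx {b : Test} {P : Program} (hP : IsTry I Viable Take P) {a : ℕ}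
    (ha : a ∉ [2, 3, 4, 5, 6, 7, 8, 9, 10, 13]) : a ∉ (phase b P).idxWrites := by
  have h1 := rounds_idx (b := b) hP ha
  simp only [phase, Program.idxWrites, List.mem_append, not_or]
  refine ⟨?_, ?_, by simp, h1⟩ <;>
    (simp [Program.for, Program.idxWrites] at ha ⊢; omega)

theorem phase_num {b : Test} {P : Program} (hP : IsTry I Viable Take P) {a : ℕ}
    (ha : a ∉ [3, 4]) : a ∉ (phase b P).numWrites := by
  have h1 := rounds_num (b := b) hP ha
  simp only [phase, Program.numWrites, List.mem_append, not_or]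
  refine ⟨?_, ?_, ?_, h1⟩
  · simp [Program.for, Program.numWrites]
  · simp [Program.for, Program.numWrites]
  · simp at ha ⊢
    omega

/-- A bound for the running time of a greedy algorithm with `R` rounds, each of which examines `F`
bins in advance. -/
def phaseTime (I : Instance) (F R : ℕ) : ℕ :=
  R * (F * (100 * I.n + 150) + I.m * 100 + 140 * I.n + 280) + 30 * I.n + 30 * I.m + 80

theorem reaches_phase {b : Test} (hb : IsOrder I κ b) {P : Program} (hP : IsTry I Viable Take P)
    {σ : State} (hI : HasInput I σ) {F R : ℕ} (hF : σ.idx 11 0 = F) (hR : σ.idx 12 0 = R)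
    (hFR : F = I.m ∧ R = I.n ∨ F = 0 ∧ R = I.m) :
    Reaches (phase b P) σ (phaseTime I F R) fun τ =>
      τ.num 3 0 ≤ (sol I (τ.idx 2)).profit ∧
      ∃ L U, Run I κ Viable Take L U (τ.num 3 0) ∧ (L = ∅ ∨ U = ∅) := by
  refine .bind (T₁ := 30 * I.n + 20)
    (T₂ := R * (F * (100 * I.n + 150) + I.m * 100 + 140 * I.n + 280) + 30 * I.m + 60)
    ((Reaches.fill (N := I.n) (fun _ => 0) (by decide) (fun τ hF => ?_)
      (fun _ _ _ _ => rfl)).mono ?_ fun _ h => h)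
    (fun ρ hFρ hρ => ?_) (by unfold phaseTime; omega)
  · simp [IExpr.eval, hF.1 0 (by decide), hI.n]
  · simp only [IExpr.cost]; omega
  have hIρ := hI.frame hFρ (by decide) (by decide)
  refine .bind (T₁ := 30 * I.m + 20)
    (T₂ := R * (F * (100 * I.n + 150) + I.m * 100 + 140 * I.n + 280) + 40)
    ((Reaches.fill (N := I.m) (fun _ => 0) (by decide) (fun τ hF => ?_)
      (fun _ _ _ _ => rfl)).mono ?_ fun _ h => h)
    (fun υ hFυ hυ => ?_) (by omega)
  · simp [IExpr.eval, hF.1 0 (by decide), hIρ.m]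
  · simp only [IExpr.cost]; omega
  have hIυ := hIρ.frame hFυ (by decide) (by decide)
  rw [← hFυ.1 2 (by decide)] at hρ
  refine .cons (T' := R * (F * (100 * I.n + 150) + I.m * 100 + 140 * I.n + 280) + 30) rfl
    (fun φ hFφ hφ => ?_) (by simp only [Program.cost, IExpr.cost, NExpr.cost]; omega)
  have hIφ := hIυ.congr (hFφ.1 0 (by decide)) fun a ha => hFφ.2 a
    (by simp [Program.numWrites]; omega)
  have hWφ : φ.num 3 0 = 0 := by simp [hφ, Program.run, IExpr.eval, NExpr.eval]
  rw [← hFφ.1 2 (by decide)] at hρ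
  rw [← hFφ.1 3 (by decide)] at hυ
  have h11 : φ.idx 11 0 = F := by
    rw [hFφ.1 11 (by decide), hFυ.1 11 (by decide), hFρ.1 11 (by decide), hF]
  have h12 : φ.idx 12 0 = R := by
    rw [hFφ.1 12 (by decide), hFυ.1 12 (by decide), hFρ.1 12 (by decide), hR]
  refine (Reaches.for (F * (100 * I.n + 150) + I.m * 100 + 140 * I.n + 250) (fun r τ =>
      PhaseInv I κ Viable Take (τ.idx 2) (τ.idx 3) (τ.num 3 0) ∧
      (live I (τ.idx 3) = ∅ ∨ ((live I (τ.idx 3)).card + r ≤ I.m ∧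
        (F = I.m → (avail I (τ.idx 2)).card + r ≤ I.n))))
    ?_ (N := R) ?_ ?_ ?_).mono ?_ ?_
  · have h1 := hP.prefilter_idx (a := 7)
    have h2 := hP.commit_idx (a := 7)
    simp [round, select, Program.for, Program.idxWrites] at h1 h2 ⊢
    tauto
  · intro τ hFτ
    simp [IExpr.eval, hFτ.1 12 (rounds_idx hP (by decide)), h12]
  · simp only [State.setIdx_num, State.setIdx_idx_of_ne _ _ _ (show 2 ≠ 7 by decide),
      State.setIdx_idx_of_ne _ _ _ (show 3 ≠ 7 by decide), hWφ]
    refine ⟨.start hρ hυ, Or.inr ⟨?_, fun _ => ?_⟩⟩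
    · simpa using Finset.card_le_univ (live I (φ.idx 3))
    · simpa using Finset.card_le_univ (avail I (φ.idx 2))
  · rintro r τ hr hFτ - ⟨h1, h2⟩
    have hIτ := hIφ.frame hFτ (rounds_idx hP (by decide))
      fun a ha => rounds_num hP (by simp; omega)
    have h11τ : τ.idx 11 0 = F := by rw [hFτ.1 11 (rounds_idx hP (by decide)), h11]
    refine (reaches_round hb hP hIτ h1 h11τ (by omega)).mono le_rfl ?_
    rintro υ ⟨h3, h4⟩
    simp only [State.setIdx_num, State.setIdx_idx_of_ne _ _ _ (show 2 ≠ 7 by decide),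
      State.setIdx_idx_of_ne _ _ _ (show 3 ≠ 7 by decide)]
    refine ⟨h3, ?_⟩
    rcases h4 with h4 | ⟨h4, h5⟩
    · exact Or.inl h4
    · rcases h2 with h2 | ⟨h2, h2'⟩
      · simp [h2] at h4
      · exact Or.inr ⟨by omega, fun hFm => by have := h5 hFm; have := h2' hFm; omega⟩
  · simp only [IExpr.cost]; ring_nf; omega
  · rintro τ ⟨-, h1, h2⟩
    refine ⟨h1.profit.ge, h1.finish ?_⟩
    rcases h2 with h2 | ⟨h2, h2'⟩
    · exact Or.inl h2
    · rcases hFR with ⟨hFR, hFR'⟩ | ⟨_, hFR'⟩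
      · exact Or.inr (Finset.card_eq_zero.1 (by have := h2' hFR; omega))
      · exact Or.inl (Finset.card_eq_zero.1 (by omega))

/-! ### The algorithm -/

/-- Compare the profits of the bins given by the variables `5` and `8`. -/
def profitOrder : Test := .numLe (.read 0 (.sub (ivar 8) (.const 1))) (.read 0 (ivar 5))

/-- Compare the densities of the bins given by the variables `5` and `8`. -/
def densityOrder : Test :=
  .mulLe (.read 0 (.sub (ivar 8) (.const 1))) (.read 1 (ivar 5))
    (.read 0 (ivar 5)) (.read 1 (.sub (ivar 8) (.const 1)))

theorem isOrder_profitOrder (I : Instance) : IsOrder I I.p profitOrder where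
  cost := by decide
  holds_iff hI hi hk := by
    simp only [profitOrder, Test.Holds, NExpr.eval, IExpr.eval, hi, hk, Nat.add_sub_cancel, hI.p]

theorem isOrder_densityOrder (I : Instance) :
    IsOrder I (fun i => I.p i / I.d i) densityOrder where
  cost := by decide
  holds_iff hI hi hk := by
    simp only [densityOrder, Test.Holds, NExpr.eval, IExpr.eval, hi, hk, Nat.add_sub_cancel, hI.p,
      hI.d]
    rw [div_le_div_iff₀ (I.d_pos _) (I.d_pos _)]

/-- Keep the current candidate if it is better than the best solution so far. -/
def store : Program :=
  .ite (.numLe (nvar 3) (nvar 5)) .skip <|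
  .seq (nassign 5 (nvar 3)) <|
  .for 6 nE (.setIdx 1 (ivar 6) (.read 2 (ivar 6)))

/-- Cover a single bin by all items. -/
def single : Program :=
  .seq (nassign 4 .zero) <|
  .seq (.for 6 nE (nassign 4 (.add (nvar 4) sizeE))) <|
  .seq (.for 5 mE
    (.ite (.numLe (.read 1 (ivar 5)) (nvar 4)) (.setIdx 3 (ivar 5) (.const 0))
      (.setIdx 3 (ivar 5) (.const 1)))) <|
  .seq (select profitOrder) <|
  .seq (.ite (.idxLe (ivar 8) (.const 0)) (nassign 3 .zero)
    (nassign 3 (.read 0 (.sub (ivar 8) (.const 1))))) <|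
  .for 6 nE (.setIdx 2 (ivar 6) (ivar 8))

/-- Determine the number of rounds of the greedy algorithms, and the number of bins that each round
examines in advance. If `n * n ≤ m`, all bins are examined in advance; then each round uses up an
item, so that `n` rounds suffice. Otherwise none is, and `m` rounds suffice, as each round treats a
bin. -/
def schedule : Program :=
  .seq (.for 6 nE (assign 14 (.add (ivar 14) nE))) <|
  .ite (.idxLe (ivar 14) mE)
    (.seq (assign 11 mE) (assign 12 nE))
    (.seq (assign 11 (.const 0)) (assign 12 mE))

/-- The approximation algorithm: the best of a greedy matching, a greedy cover by density, and the
most profitable single bin. -/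
def algorithm : Program :=
  .ite (.idxLe mE (.const 0)) .skip <|
  .ite (.idxLe nE (.const 0)) .skip <|
  .seq schedule <|
  .seq (.seq (phase profitOrder tryLarge) store) <|
  .seq (.seq (phase densityOrder trySmall) store) <|
  .seq single store

theorem reaches_store {σ : State} (hI : HasInput I σ)
    (h : σ.num 3 0 ≤ (sol I (σ.idx 2)).profit) (h' : σ.num 5 0 ≤ (sol I (σ.idx 1)).profit) :
    Reaches store σ (30 * I.n + 40) fun τ =>
      τ.num 5 0 ≤ (sol I (τ.idx 1)).profit ∧ σ.num 3 0 ≤ τ.num 5 0 ∧ σ.num 5 0 ≤ τ.num 5 0 := by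
  refine .ite (T := 30 * I.n + 30) (fun hle => ?_) (fun hle => ?_)
    (by simp only [Test.cost, IExpr.cost, NExpr.cost]; omega)
  · exact .run rfl (by simp only [Program.cost]; omega) ⟨h', hle, le_rfl⟩
  · simp only [Test.Holds, NExpr.eval, IExpr.eval, not_le] at hle
    refine .cons (T' := 30 * I.n + 20) rfl (fun ρ hFρ hρ => ?_)
      (by simp only [Program.cost, IExpr.cost, NExpr.cost]; omega)
    have hIρ := hI.frame hFρ (by decide) (by decide)
    have h5ρ : ρ.num 5 0 = σ.num 3 0 := by simp [hρ, Program.run, IExpr.eval, NExpr.eval]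
    have h2ρ : ρ.idx 2 = σ.idx 2 := hFρ.1 2 (by decide)
    refine ((Reaches.fill (N := I.n) (σ.idx 2) (by decide) (fun τ hF => ?_)
      (fun k τ hF hk => ?_)).frame).mono (by simp only [IExpr.cost]; omega) ?_
    · simp [IExpr.eval, hF.1 0 (by decide), hIρ.n]
    · simp only [IExpr.eval, hk, hF.1 2 (by decide), h2ρ]
    · rintro τ ⟨hF, hτ⟩
      rw [hF.2 5 (by decide), h5ρ, sol_congr hτ]
      exact ⟨h, le_rfl, hle.le⟩

theorem reaches_single {σ : State} (hI : HasInput I σ) :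
    Reaches single σ (60 * I.n + 160 * I.m + 120) fun τ =>
      τ.num 3 0 ≤ (sol I (τ.idx 2)).profit ∧ 0 ≤ τ.num 3 0 ∧
      ∀ i, I.d i ≤ I.size Finset.univ → I.p i ≤ τ.num 3 0 := by
  classical
  refine .cons (T' := 60 * I.n + 160 * I.m + 110) rfl (fun σ₁ hF₁ h₁ => ?_)
    (by simp only [Program.cost, IExpr.cost, NExpr.cost]; omega)
  have hI₁ := hI.frame hF₁ (by decide) (by decide)
  refine .bind (T₁ := I.n * 30 + 20) (T₂ := 30 * I.n + 160 * I.m + 90)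
    ((Reaches.for 10 (fun l τ => τ.num 4 0 = I.size {j | (j : ℕ) < l}) (by decide) (N := I.n)
      ?_ ?_ ?_).mono (by simp only [IExpr.cost]; omega) fun _ h => h.2)
    (fun σ₂ hF₂ h₂ => ?_) (by omega)
  · intro τ hF
    simp [IExpr.eval, hF.1 0 (by decide), hI₁.n]
  · simp [h₁, Program.run, IExpr.eval, NExpr.eval, Instance.size]
  · intro l τ hl hF hck hinv
    have hIτ := hI₁.frame hF (by decide) (by decide)
    refine .run rfl (by decide) ?_
    have hset : (Finset.univ.filter fun j : Fin I.n => (j : ℕ) < l + 1) =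
        insert ⟨l, hl⟩ (Finset.univ.filter fun j : Fin I.n => (j : ℕ) < l) := by
      ext j
      simp only [Finset.mem_filter, Finset.mem_univ, true_and, Finset.mem_insert, Fin.ext_iff]
      omega
    have hs := hIτ.s ⟨l, hl⟩
    simp only at hs
    simp only [Program.run, State.setIdx_num, IExpr.eval, NExpr.eval, State.setNum_num_self,
      Function.update_self, hck, hs, hinv]
    rw [hset, Instance.size, Instance.size, Finset.sum_insert (by simp), add_comm]
  have hI₂ := hI₁.frame hF₂ (by decide) (by decide)
  have hT : σ₂.num 4 0 = I.size Finset.univ := by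
    rw [h₂]
    congr 1
    ext j
    simp
  refine .bind (T₁ := I.m * 50 + 20) (T₂ := 30 * I.n + 110 * I.m + 70)
    ((Reaches.for 20 (fun l τ => ∀ i : Fin I.m, (i : ℕ) < l →
      (i ∈ live I (τ.idx 3) ↔ I.d i ≤ I.size Finset.univ)) (by decide) (N := I.m)
      ?_ ?_ ?_).mono (by simp only [IExpr.cost]; omega) fun _ h => h.2)
    (fun σ₃ hF₃ h₃ => ?_) (by omega)
  · intro τ hF
    simp [IExpr.eval, hF.1 0 (by decide), hI₂.m]
  · simp
  · intro l τ hl hF hck hinv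
    have hIτ := hI₂.frame hF (by decide) (by decide)
    have hd := hIτ.d ⟨l, hl⟩
    simp only at hd
    refine .run rfl (by decide) fun i hil => ?_
    simp only [Program.run, Test.Holds, IExpr.eval, NExpr.eval, hck, hd, hF.2 4 (by decide), hT]
    rcases fin_lt_or_eq hl hil with hil | rfl
    · rw [← hinv i hil]
      split_ifs <;> simp [hil.ne]
    · split_ifs with hc <;> simp [hc]
  have hI₃ := hI₂.frame hF₃ (by decide) (by decide)
  refine .bind (T₂ := 30 * I.n + 10 * I.m + 50) (reaches_select (isOrder_profitOrder I) hI₃)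
    (fun σ₄ hF₄ h₄ => ?_) (by omega)
  have hI₄ := hI₃.frame hF₄ (by decide) (by decide)
  have hlive : ∀ i, i ∈ live I (σ₃.idx 3) ↔ I.d i ≤ I.size Finset.univ := fun i => h₃ i i.2
  refine .cons (T' := 30 * I.n + 20) rfl (fun σ₅ hF₅ h₅ => ?_)
    (by simp only [Program.cost, Test.cost, IExpr.cost, NExpr.cost]; omega)
  have hI₅ := hI₄.frame hF₅ (by decide) (by decide)
  refine ((Reaches.fill (N := I.n) (fun _ => σ₄.idx 8 0) (by decide) (fun τ hF => ?_)
    (fun k τ hF hk => ?_)).frame).mono (by simp only [IExpr.cost]; omega) ?_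
  · simp [IExpr.eval, hF.1 0 (by decide), hI₅.n]
  · simp only [IExpr.eval, hF.1 8 (by decide), hF₅.1 8 (by decide)]
  · rintro τ ⟨hF, hτ⟩
    rw [hF.2 3 (by decide), sol_congr hτ]
    rcases h₄ with ⟨h0, hempty⟩ | ⟨k, hk, hbest, hmax⟩
    · have hW : σ₅.num 3 0 = 0 := by
        simp [h₅, Program.run, Test.Holds, IExpr.eval, NExpr.eval, h0]
      rw [hW]
      refine ⟨Solution.profit_nonneg _, le_rfl, fun i hi => ?_⟩
      rw [← hlive, hempty] at hi
      simp at hi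
    · have hW : σ₅.num 3 0 = I.p k := by
        simp [h₅, Program.run, Test.Holds, IExpr.eval, NExpr.eval, hbest, hI₄.p]
      rw [hW]
      refine ⟨?_, I.p_nonneg k, fun i hi => hmax i ((hlive i).2 hi)⟩
      have hS : (sol I fun _ => σ₄.idx 8 0).S k = Finset.univ :=
        Finset.filter_true_of_mem fun j _ => hbest
      exact Solution.le_profit _ (hS ▸ (hlive k).1 hk)

theorem reaches_schedule {σ : State} (hI : HasInput I σ) (h14 : σ.idx 14 0 = 0) :
    Reaches schedule σ (40 * I.n + 40) fun τ =>
      (I.n * I.n ≤ I.m ∧ τ.idx 11 0 = I.m ∧ τ.idx 12 0 = I.n) ∨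
      (I.m < I.n * I.n ∧ τ.idx 11 0 = 0 ∧ τ.idx 12 0 = I.m) := by
  refine .bind (T₁ := 40 * I.n + 20) (T₂ := 20) ((Reaches.for 10 (fun l τ => τ.idx 14 0 = l * I.n)
    (by decide) (N := I.n) ?_ ?_ ?_).mono (by simp only [IExpr.cost]; omega) fun _ h => h.2)
    (fun ρ hFρ hρ => ?_) le_rfl
  · intro τ hF
    simp [IExpr.eval, hF.1 0 (by decide), hI.n]
  · simpa using h14
  · intro l τ hl hF hck hinv
    refine .run rfl (by decide) ?_
    simp [Program.run, IExpr.eval, hF.1 0 (by decide), hI.n, hinv, add_mul]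
  · have hIρ := hI.frame hFρ (by decide) (by decide)
    refine .run rfl (by decide) ?_
    simp only [Program.run, Test.Holds, IExpr.eval, hρ, hIρ.m]
    split_ifs with hc
    · exact Or.inl ⟨hc, by simp, by simp [hIρ.n]⟩
    · exact Or.inr ⟨not_le.1 hc, by simp, by simp [hIρ.m]⟩

/-- The state between the parts of the algorithm: the best solution so far has at least the profit
stored for it. -/
structure MainInv (I : Instance) (F R : ℕ) (σ : State) : Prop where
  input : HasInput I σ
  bins : σ.idx 11 0 = F
  rounds : σ.idx 12 0 = R
  profit : σ.num 5 0 ≤ (sol I (σ.idx 1)).profit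

/-- A part `P` of the algorithm that constructs a candidate, followed by its comparison with the best
solution so far. -/
theorem MainInv.candidate {F R : ℕ} {σ : State} (h : MainInv I F R σ) {P : Program} {T : ℕ}
    {X : ℝ → Prop} (hidx : ∀ a ∈ [0, 1, 11, 12], a ∉ P.idxWrites)
    (hnum : ∀ a ∈ [0, 1, 2, 5], a ∉ P.numWrites)
    (hP : Reaches P σ T fun τ => τ.num 3 0 ≤ (sol I (τ.idx 2)).profit ∧ X (τ.num 3 0)) :
    Reaches (.seq P store) σ (T + (30 * I.n + 40)) fun τ =>
      MainInv I F R τ ∧ σ.num 5 0 ≤ τ.num 5 0 ∧ ∃ w ≤ τ.num 5 0, X w := by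
  refine .bind hP (fun ρ hFρ hρ => ?_) le_rfl
  have hIρ := h.input.frame hFρ (hidx 0 (by decide)) fun a ha => hnum a (by simp; omega)
  have h5ρ : ρ.num 5 = σ.num 5 := hFρ.2 5 (hnum 5 (by decide))
  refine (reaches_store hIρ hρ.1 ?_).frame.mono le_rfl ?_
  · rw [h5ρ, hFρ.1 1 (hidx 1 (by decide))]
    exact h.profit
  · rintro τ ⟨hF, h1, h2, h3⟩
    refine ⟨⟨hIρ.frame hF (by decide) (by decide), ?_, ?_, h1⟩, h5ρ ▸ h3, _, h2, hρ.2⟩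
    · rw [hF.1 11 (by decide), hFρ.1 11 (hidx 11 (by decide)), h.bins]
    · rw [hF.1 12 (by decide), hFρ.1 12 (hidx 12 (by decide)), h.rounds]

theorem Solution.profit_eq_zero (h : I.m = 0 ∨ I.n = 0) (S : Solution I) : S.profit = 0 := by
  refine Finset.sum_eq_zero fun i _ => ?_
  rcases h with h | h
  · exact absurd i.2 (by omega)
  · have : S.S i = ∅ := Finset.eq_empty_of_forall_notMem fun j _ => absurd j.2 (by omega)
    rw [this]
    exact if_neg (not_le.2 (I.d_pos i))

/-- With `n * n ≤ m` the time is `O(n * (n * m))` with `n ≤ √m`, otherwise it is `O(m * (m + n))` with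
`√m ≤ n`. -/
theorem phaseTime_le {m n F R : ℕ} (hm : 1 ≤ m) (hn : 1 ≤ n)
    (h : n * n ≤ m ∧ F = m ∧ R = n ∨ m < n * n ∧ F = 0 ∧ R = m) :
    ((R * (F * (100 * n + 150) + m * 100 + 140 * n + 280) : ℕ) : ℝ) ≤
      800 * ((n : ℝ) * m * √((m : ℝ) + n)) := by
  have hm' : (1 : ℝ) ≤ m := by exact_mod_cast hm
  have hn' : (1 : ℝ) ≤ n := by exact_mod_cast hn
  set q := √((m : ℝ) + n) with hq
  have hq1 : 1 ≤ q := Real.one_le_sqrt.2 (by linarith)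
  have hqm : √(m : ℝ) ≤ q := Real.sqrt_le_sqrt (by linarith)
  have hmn : (1 : ℝ) ≤ n * m := one_le_mul_of_one_le_of_one_le hn' hm'
  rcases h with ⟨hc, rfl, rfl⟩ | ⟨hc, rfl, rfl⟩
  · have hnq : (R : ℝ) ≤ q := by
      refine le_trans (Real.le_sqrt_of_sq_le ?_) hqm
      rw [sq]
      exact_mod_cast hc
    have h1 : (F : ℝ) * (100 * R + 150) + F * 100 + 140 * R + 280 ≤ 800 * (R * F) := by
      nlinarith [mul_nonneg (sub_nonneg.2 hm') (sub_nonneg.2 hn')]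
    push_cast
    calc (R : ℝ) * (F * (100 * R + 150) + F * 100 + 140 * R + 280)
        ≤ q * (800 * (R * F)) := by gcongr
      _ = _ := by ring
  · have hmq : (R : ℝ) ≤ n * q := by
      have h1 : √(R : ℝ) ≤ n := Real.sqrt_le_iff.2 ⟨by linarith, by
        rw [sq]; exact_mod_cast hc.le⟩
      calc (R : ℝ) = √R * √R := (Real.mul_self_sqrt (by linarith)).symm
        _ ≤ n * q := by gcongr
    have h2 : (n : ℝ) ≤ n * q := le_mul_of_one_le_right (by linarith) hq1
    push_cast
    calc (R : ℝ) * (0 * (100 * n + 150) + R * 100 + 140 * n + 280)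
        ≤ R * (800 * (n * q)) := by
          gcongr
          linarith
      _ = _ := by ring

/-- The algorithm halts in time on every instance, with a solution of at least a fifth of the optimal
profit. -/
theorem exists_exec_algorithm (I : Instance) : ∃ (t : ℕ) (σ : State),
    Exec algorithm (input I) t σ ∧ (∀ S : Solution I, S.profit ≤ 5 * (output I σ).profit) ∧
    (t : ℝ) ≤ 10000 * max 1 ((I.n : ℝ) * (I.m : ℝ) * √((I.m : ℝ) + (I.n : ℝ))) := by
  have hI := hasInput_input I
  have htriv : I.m = 0 ∨ I.n = 0 →
      ∀ σ, ∀ S : Solution I, S.profit ≤ 5 * (output I σ).profit := fun h σ S => by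
    rw [S.profit_eq_zero h, (output I σ).profit_eq_zero h, mul_zero]
  by_cases hm : I.m = 0
  · refine ⟨_, _, .iteTrue ?_ (.skip _), htriv (Or.inl hm) _, ?_⟩
    · simp [Test.Holds, IExpr.eval, hI.m, hm]
    · simp only [Test.cost, IExpr.cost]
      push_cast
      linarith [le_max_left 1 ((I.n : ℝ) * (I.m : ℝ) * √((I.m : ℝ) + (I.n : ℝ)))]
  by_cases hn : I.n = 0
  · refine ⟨_, _, .iteFalse ?_ (.iteTrue ?_ (.skip _)), htriv (Or.inr hn) _, ?_⟩
    · simp [Test.Holds, IExpr.eval, hI.m, hm]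
    · simp [Test.Holds, IExpr.eval, hI.n, hn]
    · simp only [Test.cost, IExpr.cost]
      push_cast
      linarith [le_max_left 1 ((I.n : ℝ) * (I.m : ℝ) * √((I.m : ℝ) + (I.n : ℝ)))]
  have : Nonempty (Fin I.n) := ⟨⟨0, by omega⟩⟩
  obtain ⟨F, R, hFR⟩ : ∃ F R, I.n * I.n ≤ I.m ∧ F = I.m ∧ R = I.n ∨
      I.m < I.n * I.n ∧ F = 0 ∧ R = I.m := by
    rcases le_or_gt (I.n * I.n) I.m with h | h
    · exact ⟨_, _, Or.inl ⟨h, rfl, rfl⟩⟩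
    · exact ⟨_, _, Or.inr ⟨h, rfl, rfl⟩⟩
  have hFR' : F = I.m ∧ R = I.n ∨ F = 0 ∧ R = I.m := by tauto
  have main : Reaches algorithm (input I)
      (2 * phaseTime I F R + 190 * I.n + 160 * I.m + 300) fun τ =>
        ∀ S : Solution I, S.profit ≤ 5 * (output I τ).profit := by
    refine .ite (T := 2 * phaseTime I F R + 190 * I.n + 160 * I.m + 290)
      (fun h => ?_) (fun _ => ?_) (by simp only [Test.cost, IExpr.cost]; omega)
    · simp only [Test.Holds, IExpr.eval, hI.m] at h
      omega
    refine .ite (T := 2 * phaseTime I F R + 190 * I.n + 160 * I.m + 280)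
      (fun h => ?_) (fun _ => ?_) (by simp only [Test.cost, IExpr.cost]; omega)
    · simp only [Test.Holds, IExpr.eval, hI.n] at h
      omega
    refine .bind (T₂ := 2 * phaseTime I F R + 150 * I.n + 160 * I.m + 240)
      (reaches_schedule hI (by simp [input])) (fun σ₁ hF₁ h₁ => ?_) (by omega)
    have hinv₁ : MainInv I F R σ₁ := by
      refine ⟨hI.frame hF₁ (by decide) (by decide), by omega, by omega, ?_⟩
      rw [hF₁.2 5 (by decide)]
      simpa [input] using Solution.profit_nonneg _
    have hLi : ∀ a ∈ [0, 1, 11, 12], a ∉ [2, 3, 4, 5, 6, 7, 8, 9, 10, 13] := by decide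
    have hLn : ∀ a ∈ [0, 1, 2, 5], a ∉ [3, 4] := by decide
    refine .bind (T₁ := phaseTime I F R + (30 * I.n + 40))
      (T₂ := phaseTime I F R + 120 * I.n + 160 * I.m + 200)
      (hinv₁.candidate (fun a ha => phase_idx (isTry_tryLarge I) (hLi a ha))
        (fun a ha => phase_num (isTry_tryLarge I) (hLn a ha))
        (X := fun w => ∃ L U, Run I I.p (LargeViable I) (LargeTake I) L U w ∧
          (L = ∅ ∨ U = ∅))
        (reaches_phase (isOrder_profitOrder I) (isTry_tryLarge I) hinv₁.input hinv₁.bins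
          hinv₁.rounds hFR')) (fun σ₂ _ h₂ => ?_) (by omega)
    obtain ⟨hinv₂, -, w, hw, L, U, hrun, hend⟩ := h₂
    refine .bind (T₁ := phaseTime I F R + (30 * I.n + 40))
      (T₂ := 90 * I.n + 160 * I.m + 160)
      (hinv₂.candidate (fun a ha => phase_idx (isTry_trySmall I) (hLi a ha))
        (fun a ha => phase_num (isTry_trySmall I) (hLn a ha))
        (X := fun w => ∃ L U, Run I (fun i => I.p i / I.d i) (SmallViable I) (SmallTake I) L U w ∧
          (L = ∅ ∨ U = ∅))
        (reaches_phase (isOrder_densityOrder I) (isTry_trySmall I) hinv₂.input hinv₂.bins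
          hinv₂.rounds hFR')) (fun σ₃ _ h₃ => ?_) (by omega)
    obtain ⟨hinv₃, hle₃, w', hw', L', U', hrun', hend'⟩ := h₃
    refine (hinv₃.candidate (by decide) (by decide)
      (X := fun v => 0 ≤ v ∧ ∀ i, I.d i ≤ I.size Finset.univ → I.p i ≤ v)
      (reaches_single hinv₃.input)).mono (by omega) ?_
    rintro τ ⟨hinv, hle, v, hv, hv0, hv'⟩ S
    have h1 := Solution.profit_le hrun hend hrun' hend' hv0 hv' S
    have h2 : τ.num 5 0 ≤ (output I τ).profit := hinv.profit
    linarith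
  obtain ⟨t, σ, h1, h2, h3⟩ := main
  refine ⟨t, σ, h1, h3, ?_⟩
  have hpt := phaseTime_le (by omega) (by omega) hFR
  have hm' : (1 : ℝ) ≤ I.m := by exact_mod_cast Nat.one_le_iff_ne_zero.2 hm
  have hn' : (1 : ℝ) ≤ I.n := by exact_mod_cast Nat.one_le_iff_ne_zero.2 hn
  have hq1 : 1 ≤ √((I.m : ℝ) + I.n) := Real.one_le_sqrt.2 (by linarith)
  have hnm : (I.n : ℝ) * I.m ≤ I.n * I.m * √((I.m : ℝ) + I.n) :=
    le_mul_of_one_le_right (by positivity) hq1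
  have hn1 : (I.n : ℝ) ≤ I.n * I.m := le_mul_of_one_le_right (by linarith) hm'
  have hm1 : (I.m : ℝ) ≤ I.n * I.m := le_mul_of_one_le_left (by linarith) hn'
  refine le_trans ?_ (mul_le_mul_of_nonneg_left (le_max_right _ _) (by norm_num))
  have h2' : (t : ℝ) ≤ ((2 * phaseTime I F R + 190 * I.n + 160 * I.m + 300 : ℕ) : ℝ) := by
    exact_mod_cast h2
  unfold phaseTime at h2'
  rw [show 2 * (R * (F * (100 * I.n + 150) + I.m * 100 + 140 * I.n + 280) + 30 * I.n + 30 * I.m +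
      80) + 190 * I.n + 160 * I.m + 300 =
      2 * (R * (F * (100 * I.n + 150) + I.m * 100 + 140 * I.n + 280)) + 250 * I.n + 220 * I.m +
      460 by ring] at h2'
  rw [Nat.cast_add, Nat.cast_add, Nat.cast_add, Nat.cast_mul 2] at h2'
  push_cast at h2' hpt
  linarith

end GBC

theorem theorem1 :
    ∃ (alg : (I : GBC.Instance) → GBC.Solution I) (P : GBC.Program),
      GBC.approxRatio alg ≤ 5 ∧
      GBC.ImplementsInTime P alg (fun m n => (n : ℝ) * (m : ℝ) * √((m : ℝ) + (n : ℝ))) := by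
  choose t σ hexec hprofit ht using GBC.exists_exec_algorithm
  refine ⟨fun I => GBC.output I (σ I), GBC.algorithm, ?_, 10000,
    fun I => ⟨t I, σ I, hexec I, rfl, ht I⟩⟩
  simpa using GBC.approxRatio_le (alg := fun I => GBC.output I (σ I)) (a := 5) (by norm_num) hprofit
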